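/- **Setting.** Fix $\beta>0$. Let $\mathcal A$ be an infinite set of arms whose initial mean rewards $\{\mu_1(a)\}_{a\in\mathcal A}$ are i.i.d. random variables with values in $[0,1]$ such that, for constants $0<c_\ell\le c_h$ and all $x\in[0,1]$, $$c_\ell x^\beta\le \mathbb P(1-\mu_1(a)<x)\le c_h x^\beta .$$ In round $t=1,\dots,T$ an arm $a_t$ is pulled and the reward $r_t=\mu_t(a_t)+\eta_t$ is observed; then $\mu_{t+1}(a_t)=\mu_t(a_t)-\rho_t$, and $\mu_{t+1}(a)=\mu_t(a)$ for $a\ne a_t$ (mean rewards may become negative). The rotting rates $\rho_t\ge 0$ are chosen, right after the pull of round $t$, by an adaptive adversary: there is a filtration $(\mathcal F_t)_{t\ge0}$ such that all $\mu_1(a)$ are $\mathcal F_0$-measurable, $\eta_t$ and $\rho_t$ are $\mathcal F_t$-measurable, and the noise is conditionally $1$-sub-Gaussian, $\mathbb E[e^{\lambda\eta_t}\mid\mathcal F_{t-1}]\le e^{\lambda^2/2}$ almost surely for all $\lambda\in\mathbb R$. Almost surely $\sum_{t=1}^{T-1}\rho_t\le T$ and, for a given $S_T\in\{1,\dots,T\}$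 (abrupt rotting), $1+\sum_{t=1}^{T-1}\mathbf 1(\rho_t\ne0)\le S_T$. Put $\bar V_T=\sum_{t=1}^{T-1}\mathbb E[\rho_t]$. **Algorithm with threshold $\delta$.** New arms are taken in a fixed order $\bar a_1,\bar a_2,\dots$ of distinct arms. In round $1$ pull a new arm. In round $t=2,\dots,T$ let $a=a_{t-1}$ and let $t(a)$ be the round of its first pull. If $$\min_{s}\Bigl(\widehat\mu_{[s,t-1]}(a)+\sqrt{12\log T/n_{[s,t-1]}(a)}\Bigr)<1-\delta,$$ the minimum being over all $s$ with $t(a)\le s\le t-1$ and $s=t-2^{i-1}$ for some integer $i\ge1$, then withdraw $a$ for good and pull a new arm; otherwise pull $a$ again. Here $n_{[s,t-1]}(a)$ is the number of pulls of $a$ in rounds $s,\dots,t-1$ and $\widehat\mu_{[s,t-1]}(a)$ is the average of the rewards they gave. **Theorem.** Let $0<c_1<1$ and let $\delta=\delta_S(\beta)$, where $\delta_S(\beta)=c_1(S_T/T)^{1/(\beta+1)}$ if $\beta\ge1$ and $\delta_S(\beta)=c_1(S_T/T)^{1/2}$ if $0<\beta<1$. There are $C>0$ and $k\in\mathbb N$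 depending only on $\beta,c_1,c_\ell,c_h$ such that for all $T\ge2$, all $S_T\in\{1,\dots,T\}$ and all environments as above, the regret $R(T)=\sum_{t=1}^T(1-\mu_t(a_t))$ of the algorithm is integrable and $$\mathbb E[R(T)]\le C(\log T)^k\max\bigl\{S_T^{1/(\beta+1)}T^{\beta/(\beta+1)},\ \bar V_T\bigr\}\quad\text{if }\beta\ge1,$$ $$\mathbb E[R(T)]\le C(\log T)^k\max\bigl\{\sqrt{S_TT},\ \bar V_T\bigr\}\quad\text{if }0<\beta<1.$$ -/

import Mathlib

open MeasureTheory ProbabilityTheory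

noncomputable section

namespace RottingBandit

/-! ### The algorithm: UCB-threshold with adaptive sliding window

Rounds are numbered `1, 2, …, T`. -/

/-- `n_{[t₁,t₂]}(x)`: the number of rounds in `[t₁, t₂]` in which arm `x` was pulled. -/
def pullCount {𝒜 : Type*} [DecidableEq 𝒜] (a : ℕ → 𝒜) (x : 𝒜) (t₁ t₂ : ℕ) : ℕ :=
  ((Finset.Icc t₁ t₂).filter fun t => a t = x).card

/-- `μ̂_{[t₁,t₂]}(x)`: the empirical mean of the rewards of arm `x` in the rounds `[t₁, t₂]`. -/
def empMean {𝒜 : Type*} [DecidableEq 𝒜] (a : ℕ → 𝒜) (r : ℕ → ℝ) (x : 𝒜) (t₁ t₂ : ℕ) : ℝ :=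
  (∑ t ∈ Finset.Icc t₁ t₂, if a t = x then r t else 0) / (pullCount a x t₁ t₂ : ℝ)

/-- `WUCB(x, t₁, t₂, T)`: the window-UCB index. -/
def wucb {𝒜 : Type*} [DecidableEq 𝒜] (T : ℕ) (a : ℕ → 𝒜) (r : ℕ → ℝ) (x : 𝒜) (t₁ t₂ : ℕ) : ℝ :=
  empMean a r x t₁ t₂ + Real.sqrt (12 * Real.log (T : ℝ) / (pullCount a x t₁ t₂ : ℝ))

/-- The set of starting times of the windows of doubling length that are examined in round `t`,
for an arm first pulled in round `t₀`:
`s ∈ [T]` with `t₀ ≤ s ≤ t - 1` and `s = t - 2 ^ (i - 1)` for some `i ≥ 1`. -/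
def windowStarts (T t₀ t : ℕ) : Set ℕ :=
  {s | 1 ≤ s ∧ s ≤ T ∧ t₀ ≤ s ∧ s < t ∧ ∃ j : ℕ, s + 2 ^ j = t}

/-- The threshold condition `min_{s} WUCB(x, s, t - 1, T) < 1 - δ` of round `t`, the minimum being
over the (finite) set of window starts. -/
def thresholdMet {𝒜 : Type*} [DecidableEq 𝒜] (T : ℕ) (δ : ℝ) (a : ℕ → 𝒜) (r : ℕ → ℝ)
    (x : 𝒜) (t₀ t : ℕ) : Prop :=
  ∃ s ∈ windowStarts T t₀ t, wucb T a r x s (t - 1) < 1 - δ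

/-- The state right after the pull of a round `t`, before the pulled arm rots. -/
structure RunState (𝒜 : Type*) where
  /-- the number of arms withdrawn so far -/
  idx : ℕ
  /-- the round in which the current arm was selected -/
  start : ℕ
  /-- `arm s` is the arm pulled in round `s`, for `1 ≤ s ≤ t` -/
  arm : ℕ → 𝒜
  /-- `reward s` is the reward observed in round `s`, for `1 ≤ s ≤ t` -/
  reward : ℕ → ℝ
  /-- `mean x` is the mean reward of arm `x` at time `t` -/
  mean : 𝒜 → ℝ

/-- Pull arm `x` in round `t`, when the current mean rewards are `μ` and the noise is `ε`. -/
def pull {𝒜 : Type*} (t : ℕ) (x : 𝒜) (ε : ℝ) (idx start : ℕ) (a : ℕ → 𝒜) (r : ℕ → ℝ)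
    (μ : 𝒜 → ℝ) : RunState 𝒜 where
  idx := idx
  start := start
  arm := Function.update a t x
  reward := Function.update r t (μ x + ε)
  mean := μ

open Classical in
/-- The run of the algorithm with horizon `T` and threshold `δ` that takes new arms in the order
`order 0, order 1, …`, against initial mean rewards `m`, noise `η` and rotting rates `ρ`.
The value at `0` is a placeholder for the empty history. After round `t ≥ 1` only the pulled
arm `a_t` rots, by `ρ t`; in the next round the algorithm withdraws it and takes the next new arm
if the threshold condition holds, and pulls it again otherwise. -/
def run {𝒜 : Type*} [DecidableEq 𝒜] (T : ℕ) (δ : ℝ) (order : ℕ → 𝒜) (m : 𝒜 → ℝ)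
    (η ρ : ℕ → ℝ) : ℕ → RunState 𝒜
  | 0 => ⟨0, 1, fun _ => order 0, fun _ => 0, m⟩
  | 1 => pull 1 (order 0) (η 1) 0 1 (fun _ => order 0) (fun _ => 0) m
  | t + 2 =>
    let σ := run T δ order m η ρ (t + 1)
    let x := σ.arm (t + 1)
    let μ : 𝒜 → ℝ := fun y => if y = x then σ.mean y - ρ (t + 1) else σ.mean y
    if thresholdMet T δ σ.arm σ.reward x σ.start (t + 2) then
      pull (t + 2) (order (σ.idx + 1)) (η (t + 2)) (σ.idx + 1) (t + 2) σ.arm σ.reward μ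
    else
      pull (t + 2) x (η (t + 2)) σ.idx σ.start σ.arm σ.reward μ

/-- The regret `R(T) = ∑_{t=1}^T (1 - μ_t(a_t))` along one realization. -/
def regret {𝒜 : Type*} [DecidableEq 𝒜] (T : ℕ) (δ : ℝ) (order : ℕ → 𝒜) (m : 𝒜 → ℝ)
    (η ρ : ℕ → ℝ) : ℝ :=
  ∑ t ∈ Finset.Icc 1 T,
    (1 - (run T δ order m η ρ t).mean ((run T δ order m η ρ t).arm t))

/-- The threshold `δ_S(β)`. -/
def deltaS (c₁ β : ℝ) (S T : ℕ) : ℝ :=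
  if 1 ≤ β then c₁ * ((S : ℝ) / (T : ℝ)) ^ (1 / (β + 1))
  else c₁ * ((S : ℝ) / (T : ℝ)) ^ ((1 : ℝ) / 2)

/-! ### The environment -/

/-- `X` is conditionally `1`-sub-Gaussian given the σ-algebra `𝓖`:
`E[exp (l X) | 𝓖] ≤ exp (l² / 2)` almost surely, for every real `l`. (Unlike
`HasCondSubgaussianMGF` this makes sense on every probability space.) -/
def IsCondSubGaussian {Ω : Type*} {mΩ : MeasurableSpace Ω} (P : Measure Ω)
    (𝓖 : MeasurableSpace Ω) (X : Ω → ℝ) : Prop :=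
  ∀ l : ℝ, Integrable (fun ω => Real.exp (l * X ω)) P ∧
    P[fun ω => Real.exp (l * X ω) | 𝓖] ≤ᵐ[P] fun _ => Real.exp (l ^ 2 / 2)

/-- The abrupt rotting environment with horizon `T` and budget `S`. The σ-algebra `ℱ t` is what an
adaptive adversary may use when it fixes the rotting rate `ρ t`, right after the pull of round `t`;
it may know everything up to then, including the noise of round `t`, all initial mean rewards and
private randomness, but the noise of later rounds stays conditionally sub-Gaussian. -/
structure IsAbruptRottingEnv {Ω : Type*} {mΩ : MeasurableSpace Ω} {𝒜 : Type*} (P : Measure Ω)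
    (ℱ : Filtration ℕ mΩ) (β cl ch : ℝ) (T S : ℕ)
    (μ₁ : 𝒜 → Ω → ℝ) (η ρ : ℕ → Ω → ℝ) : Prop where
  /-- the initial mean rewards are i.i.d. on `[0, 1]` -/
  mean_indep : iIndepFun μ₁ P
  mean_ident : ∀ x y, IdentDistrib (μ₁ x) (μ₁ y) P P
  mean_mem : ∀ x, ∀ᵐ ω ∂P, μ₁ x ω ∈ Set.Icc (0 : ℝ) 1
  /-- `P(Δ₁(x) < z) = Θ(z ^ β)` on `[0, 1]`, with constants `cl` and `ch` -/
  mean_tail : ∀ x, ∀ z ∈ Set.Icc (0 : ℝ) 1,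
    cl * z ^ β ≤ P.real {ω | 1 - μ₁ x ω < z} ∧ P.real {ω | 1 - μ₁ x ω < z} ≤ ch * z ^ β
  mean_meas : ∀ x, Measurable[ℱ 0] (μ₁ x)
  noise_meas : ∀ t ∈ Finset.Icc 1 T, Measurable[ℱ t] (η t)
  noise_subGaussian : ∀ t ∈ Finset.Icc 1 T, IsCondSubGaussian P (ℱ (t - 1)) (η t)
  rot_meas : ∀ t ∈ Finset.Ico 1 T, Measurable[ℱ t] (ρ t)
  rot_nonneg : ∀ t ∈ Finset.Ico 1 T, ∀ᵐ ω ∂P, 0 ≤ ρ t ω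
  /-- the total amount of rotting is at most `T` -/
  rot_total : ∀ᵐ ω ∂P, ∑ t ∈ Finset.Ico 1 T, ρ t ω ≤ (T : ℝ)
  /-- the number of rotting instances, plus one, is at most `S` -/
  rot_abrupt : ∀ᵐ ω ∂P, 1 + ((Finset.Ico 1 T).filter fun t => ρ t ω ≠ 0).card ≤ S

/-- The expected total rotting `V̄_T = ∑_{t=1}^{T-1} E[ρ_t]`. -/
def expectedRotting {Ω : Type*} {mΩ : MeasurableSpace Ω} (P : Measure Ω) (ρ : ℕ → Ω → ℝ)
    (T : ℕ) : ℝ :=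
  ∑ t ∈ Finset.Ico 1 T, ∫ ω, ρ t ω ∂P

/-- The regret `R(T)` as a random variable, for the algorithm with threshold `δ`. -/
def regretRV {Ω : Type*} {𝒜 : Type*} [DecidableEq 𝒜] (T : ℕ) (δ : ℝ) (order : ℕ → 𝒜)
    (μ₁ : 𝒜 → Ω → ℝ) (η ρ : ℕ → Ω → ℝ) : Ω → ℝ :=
  fun ω => regret T δ order (fun x => μ₁ x ω) (fun t => η t ω) (fun t => ρ t ω)

end RottingBandit

end

/-! Everything is expressed through the gap `D t = 1 - μ_t(a_t)` of the pulled arm. With high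
probability the noise over every window of length `n` sums to at most `√(12 n log T)` in absolute
value. The complement has probability at most `2 / T ^ 4`, and there the regret is still at most `2
T ^ 2`, so it costs `O(1)`. On the good event two facts hold. An arm whose gap stays constant below
`δ` is never withdrawn (`not_withdraws_of_gap_lt`), so each withdrawn good arm has rotted, and fewer
than `S` good arms are withdrawn. A stretch of constant gap `d > 2 δ` lasts `O(1 + log T / d ^ 2)`
rounds (`lt_of_segment`), because a dyadic window filling it triggers withdrawal; it costs `d +
O(log T / d)`.

Rounds with gap at most `2 δ` cost at most `2 δ T` in total. Every other stretch begins with a new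
arm or right after a rotting. At most `S` begin after a rotting. Their `log T / d` terms sum to `O(S
log T / δ)`. Gaps beyond the largest confidence radius occur at most once per arm, so their sum is
paid by the total rotting (`sum_large_gap_le`). For new arms, a Wald argument
(`integral_sum_goodCount_le`) bounds the expected cost by `log T * S / (cl δ ^ β)` times the
truncated mean of `1 / x`, where `x` is an initial gap. That mean is `O(1 + log (1 / δ))` for `β ≥
1` and `O(δ ^ (β - 1))` for `β < 1`. The threshold balances `δ T` against `S / δ ^ β` in the first
case and against `S / δ` in the second. -/

noncomputable section

namespace RottingBandit

/-! ### Trajectories of the algorithm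

In a run every arm is pulled in one block of consecutive rounds, so the run is described by the
number `I t` of arms withdrawn before round `t`, the first round `B t` of the current block, and
the gap `D t` of the arm pulled in round `t`. -/

/-- The arm whose block started in round `b` is withdrawn after round `t`. -/
def Withdraws (T : ℕ) (δ : ℝ) (η D : ℕ → ℝ) (b t : ℕ) : Prop :=
  ∃ j : ℕ, b + 2 ^ j ≤ t + 1 ∧
    (∑ u ∈ Finset.Ico (t + 1 - 2 ^ j) (t + 1), (1 - D u + η u)) / 2 ^ j +
      Real.sqrt (12 * Real.log T / 2 ^ j) < 1 - δ

/-- The block description of a run with initial gaps `x`, noise `η` and rotting rates `ρ`. -/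
structure IsTrajectory (T : ℕ) (δ : ℝ) (x η ρ : ℕ → ℝ) (I B : ℕ → ℕ) (D : ℕ → ℝ) : Prop where
  idx_one : I 1 = 0
  start_one : B 1 = 1
  gap_one : D 1 = x 0
  withdraw : ∀ t, 1 ≤ t → t < T → Withdraws T δ η D (B t) t →
    I (t + 1) = I t + 1 ∧ B (t + 1) = t + 1 ∧ D (t + 1) = x (I t + 1)
  keep : ∀ t, 1 ≤ t → t < T → ¬ Withdraws T δ η D (B t) t →
    I (t + 1) = I t ∧ B (t + 1) = B t ∧ D (t + 1) = D t + ρ t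

/-! ### Reduction of the algorithm to its block description -/

section Run

variable {𝒜 : Type*} [DecidableEq 𝒜] (T : ℕ) (δ : ℝ) (order : ℕ → 𝒜) (m : 𝒜 → ℝ) (η ρ : ℕ → ℝ)

/-- The gap of the arm pulled in round `t`. -/
def runGap (t : ℕ) : ℝ :=
  1 - (run T δ order m η ρ t).mean ((run T δ order m η ρ t).arm t)

/-- What is known about the state after round `t`. -/
structure RunInvariant (t : ℕ) : Prop where
  arm_eq : ∀ s, 1 ≤ s → s ≤ t →
    (run T δ order m η ρ t).arm s = order (run T δ order m η ρ s).idx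
  reward_eq : ∀ s, 1 ≤ s → s ≤ t →
    (run T δ order m η ρ t).reward s = 1 - runGap T δ order m η ρ s + η s
  one_le_start : 1 ≤ (run T δ order m η ρ t).start
  start_le : (run T δ order m η ρ t).start ≤ t
  idx_eq : ∀ s, (run T δ order m η ρ t).start ≤ s → s ≤ t →
    (run T δ order m η ρ s).idx = (run T δ order m η ρ t).idx
  mean_eq : ∀ j, (run T δ order m η ρ t).idx < j →
    (run T δ order m η ρ t).mean (order j) = m (order j)

/-- The mean rewards at the beginning of round `t + 1`. -/
def rottedMean (t : ℕ) : 𝒜 → ℝ := fun y =>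
  if y = (run T δ order m η ρ t).arm t then (run T δ order m η ρ t).mean y - ρ t
  else (run T δ order m η ρ t).mean y

variable {T δ order m η ρ}

theorem run_succ_of_met {t : ℕ} (ht : 1 ≤ t)
    (h : thresholdMet T δ (run T δ order m η ρ t).arm (run T δ order m η ρ t).reward
      ((run T δ order m η ρ t).arm t) (run T δ order m η ρ t).start (t + 1)) :
    run T δ order m η ρ (t + 1) =
      pull (t + 1) (order ((run T δ order m η ρ t).idx + 1)) (η (t + 1))
        ((run T δ order m η ρ t).idx + 1) (t + 1) (run T δ order m η ρ t).arm
        (run T δ order m η ρ t).reward (rottedMean T δ order m η ρ t) := by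
  obtain ⟨t, rfl⟩ : ∃ u, t = u + 1 := ⟨t - 1, by omega⟩
  rw [run]
  exact if_pos h

theorem run_succ_of_not_met {t : ℕ} (ht : 1 ≤ t)
    (h : ¬ thresholdMet T δ (run T δ order m η ρ t).arm (run T δ order m η ρ t).reward
      ((run T δ order m η ρ t).arm t) (run T δ order m η ρ t).start (t + 1)) :
    run T δ order m η ρ (t + 1) =
      pull (t + 1) ((run T δ order m η ρ t).arm t) (η (t + 1))
        (run T δ order m η ρ t).idx (run T δ order m η ρ t).start (run T δ order m η ρ t).arm
        (run T δ order m η ρ t).reward (rottedMean T δ order m η ρ t) := by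
  obtain ⟨t, rfl⟩ : ∃ u, t = u + 1 := ⟨t - 1, by omega⟩
  rw [run]
  exact if_neg h

theorem runInvariant_one : RunInvariant T δ order m η ρ 1 where
  arm_eq s h1 h2 := by
    obtain rfl : s = 1 := by omega
    simp [run, pull]
  reward_eq s h1 h2 := by
    obtain rfl : s = 1 := by omega
    simp [run, pull, runGap]
  one_le_start := by simp [run, pull]
  start_le := by simp [run, pull]
  idx_eq s h1 h2 := by
    have : s = 1 := by
      have : (run T δ order m η ρ 1).start = 1 := by simp [run, pull]
      omega
    rw [this]
  mean_eq j _ := by simp [run, pull]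

theorem RunInvariant.rottedMean_eq (hord : Function.Injective order) {t : ℕ} (ht : 1 ≤ t)
    (h : RunInvariant T δ order m η ρ t) {j : ℕ} (hj : (run T δ order m η ρ t).idx < j) :
    rottedMean T δ order m η ρ t (order j) = m (order j) := by
  rw [rottedMean, if_neg, h.mean_eq j hj]
  rw [h.arm_eq t ht le_rfl]
  intro he
  have := hord he
  omega

theorem RunInvariant.succ (hord : Function.Injective order) {t : ℕ} (ht : 1 ≤ t)
    (h : RunInvariant T δ order m η ρ t) : RunInvariant T δ order m η ρ (t + 1) := by
  by_cases hm : thresholdMet T δ (run T δ order m η ρ t).arm (run T δ order m η ρ t).reward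
      ((run T δ order m η ρ t).arm t) (run T δ order m η ρ t).start (t + 1)
  · have e := run_succ_of_met ht hm
    have hidx : (run T δ order m η ρ (t + 1)).idx = (run T δ order m η ρ t).idx + 1 := by
      rw [e]; rfl
    have hstart : (run T δ order m η ρ (t + 1)).start = t + 1 := by rw [e]; rfl
    refine ⟨fun s h1 h2 => ?_, fun s h1 h2 => ?_, by omega, by omega, fun s h1 h2 => ?_,
      fun j hj => ?_⟩
    · rcases Nat.lt_or_ge t s with h3 | h3
      · obtain rfl : s = t + 1 := by omega
        rw [hidx, e]; simp [pull]
      · rw [← h.arm_eq s h1 h3, e]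
        simp [pull, Function.update_of_ne (show s ≠ t + 1 by omega)]
    · rcases Nat.lt_or_ge t s with h3 | h3
      · obtain rfl : s = t + 1 := by omega
        rw [runGap, e]; simp [pull]
      · rw [← h.reward_eq s h1 h3, e]
        simp [pull, Function.update_of_ne (show s ≠ t + 1 by omega)]
    · obtain rfl : s = t + 1 := by omega
      rfl
    · rw [hidx] at hj
      rw [e]
      exact h.rottedMean_eq hord ht (by omega)
  · have e := run_succ_of_not_met ht hm
    have hidx : (run T δ order m η ρ (t + 1)).idx = (run T δ order m η ρ t).idx := by
      rw [e]; rfl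
    have hstart : (run T δ order m η ρ (t + 1)).start = (run T δ order m η ρ t).start := by
      rw [e]; rfl
    have := h.one_le_start
    have := h.start_le
    refine ⟨fun s h1 h2 => ?_, fun s h1 h2 => ?_, by omega, by omega, fun s h1 h2 => ?_,
      fun j hj => ?_⟩
    · rcases Nat.lt_or_ge t s with h3 | h3
      · obtain rfl : s = t + 1 := by omega
        rw [hidx, e, ← h.arm_eq t ht le_rfl]; simp [pull]
      · rw [← h.arm_eq s h1 h3, e]
        simp [pull, Function.update_of_ne (show s ≠ t + 1 by omega)]
    · rcases Nat.lt_or_ge t s with h3 | h3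
      · obtain rfl : s = t + 1 := by omega
        rw [runGap, e]; simp [pull]
      · rw [← h.reward_eq s h1 h3, e]
        simp [pull, Function.update_of_ne (show s ≠ t + 1 by omega)]
    · rcases Nat.lt_or_ge t s with h3 | h3
      · obtain rfl : s = t + 1 := by omega
        rfl
      · rw [hidx, h.idx_eq s (by omega) h3]
    · rw [hidx] at hj
      rw [e]
      exact h.rottedMean_eq hord ht hj

theorem runInvariant (hord : Function.Injective order) {t : ℕ} (ht : 1 ≤ t) :
    RunInvariant T δ order m η ρ t := by
  induction t, ht using Nat.le_induction with
  | base => exact runInvariant_one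
  | succ t ht ih => exact ih.succ hord ht

/-- The window indices only involve rounds of the current block. -/
theorem wucb_run (hord : Function.Injective order) {t s j : ℕ} (ht : 1 ≤ t)
    (hs : (run T δ order m η ρ t).start ≤ s) (hj : s + 2 ^ j = t + 1) :
    wucb T (run T δ order m η ρ t).arm (run T δ order m η ρ t).reward
        ((run T δ order m η ρ t).arm t) s t =
      (∑ u ∈ Finset.Ico (t + 1 - 2 ^ j) (t + 1), (1 - runGap T δ order m η ρ u + η u)) / 2 ^ j +
        Real.sqrt (12 * Real.log T / 2 ^ j) := by
  have h := runInvariant (T := T) (δ := δ) (m := m) (η := η) (ρ := ρ) hord ht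
  have h1 := h.one_le_start
  have hs' : t + 1 - 2 ^ j = s := by omega
  have harm : ∀ u ∈ Finset.Icc s t,
      (run T δ order m η ρ t).arm u = (run T δ order m η ρ t).arm t := by
    intro u hu
    rw [Finset.mem_Icc] at hu
    rw [h.arm_eq u (by omega) hu.2, h.arm_eq t ht le_rfl, h.idx_eq u (by omega) hu.2]
  have hcount : pullCount (run T δ order m η ρ t).arm ((run T δ order m η ρ t).arm t) s t
      = 2 ^ j := by
    have h2 : 0 < 2 ^ j := by positivity
    rw [pullCount, Finset.filter_true_of_mem harm, Nat.card_Icc]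
    omega
  rw [wucb, empMean, hcount, hs', Nat.cast_pow, Nat.cast_ofNat]
  congr 2
  refine Finset.sum_congr (by ext u; simp) fun u hu => ?_
  have hu' : u ∈ Finset.Icc s t := by simp at hu ⊢; omega
  rw [if_pos (harm u hu')]
  rw [Finset.mem_Icc] at hu'
  exact h.reward_eq u (by omega) hu'.2

/-- Window starts and exponents correspond through `s = t + 1 - 2 ^ j`; the condition `b + 2 ^ j ≤ t
+ 1` prevents truncation of the subtraction, and `t < T` makes the constraint `s ≤ T` automatic. -/
theorem thresholdMet_run_iff (hord : Function.Injective order) {t : ℕ} (ht : 1 ≤ t) (htT : t < T) :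
    thresholdMet T δ (run T δ order m η ρ t).arm (run T δ order m η ρ t).reward
        ((run T δ order m η ρ t).arm t) (run T δ order m η ρ t).start (t + 1) ↔
      Withdraws T δ η (runGap T δ order m η ρ) (run T δ order m η ρ t).start t := by
  have h1 := (runInvariant (T := T) (δ := δ) (m := m) (η := η) (ρ := ρ) hord ht).one_le_start
  constructor
  · rintro ⟨s, ⟨_, _, h3, _, j, hj⟩, hw⟩
    refine ⟨j, by omega, ?_⟩
    rwa [← wucb_run hord ht h3 hj]
  · rintro ⟨j, hj, hw⟩
    have h2 : 0 < 2 ^ j := by positivity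
    refine ⟨t + 1 - 2 ^ j, ⟨by omega, by omega, by omega, by omega, j, by omega⟩, ?_⟩
    rw [Nat.add_sub_cancel, wucb_run hord ht (by omega) (show t + 1 - 2 ^ j + 2 ^ j = t + 1 by omega)]
    exact hw

/-- From here on the algorithm enters only through `IsTrajectory`. Injectivity of `order` ensures
that a new arm still has its initial mean. -/
theorem isTrajectory_run (hord : Function.Injective order) :
    IsTrajectory T δ (fun i => 1 - m (order i)) η ρ (fun t => (run T δ order m η ρ t).idx)
      (fun t => (run T δ order m η ρ t).start) (runGap T δ order m η ρ) where
  idx_one := by simp [run, pull]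
  start_one := by simp [run, pull]
  gap_one := by simp [runGap, run, pull]
  withdraw t ht htT hw := by
    have e := run_succ_of_met ht ((thresholdMet_run_iff hord ht htT).2 hw)
    refine ⟨by rw [e]; rfl, by rw [e]; rfl, ?_⟩
    rw [runGap, e]
    simp only [pull, Function.update_self]
    rw [(runInvariant hord ht).rottedMean_eq hord ht (Nat.lt_succ_self _)]
  keep t ht htT hw := by
    have e := run_succ_of_not_met ht (fun h => hw ((thresholdMet_run_iff hord ht htT).1 h))
    refine ⟨by rw [e]; rfl, by rw [e]; rfl, ?_⟩
    rw [runGap, e, runGap]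
    simp only [pull, Function.update_self, rottedMean, if_true]
    ring

end Run

/-! ### Withdrawal under controlled noise -/

/-- All averages of the noise over windows of rounds are within the confidence radius. -/
def NoiseControlled (T : ℕ) (η : ℕ → ℝ) : Prop :=
  ∀ s n : ℕ, 1 ≤ s → 1 ≤ n → s + n ≤ T + 1 →
    |∑ u ∈ Finset.Ico s (s + n), η u| ≤ Real.sqrt (12 * Real.log T * n)

/-- The number of the first `i` arms whose initial gap is below `δ`. -/
def goodCount (δ : ℝ) (x : ℕ → ℝ) (i : ℕ) : ℕ :=
  ((Finset.range i).filter fun k => x k < δ).card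

/-- The truncated inverse `1 / y` of a gap `y > 2 δ`. -/
def truncInv (δ y : ℝ) : ℝ := if 2 * δ < y then y⁻¹ else 0

theorem truncInv_nonneg {δ : ℝ} (hδ : 0 < δ) (y : ℝ) : 0 ≤ truncInv δ y := by
  rw [truncInv]
  split_ifs
  · exact inv_nonneg.2 (by linarith)
  · exact le_rfl

theorem sqrt_mul_div_eq_sqrt_div {L n : ℝ} (hL : 0 ≤ L) (hn : 0 < n) :
    Real.sqrt (L * n) / n = Real.sqrt (L / n) := by
  rw [Real.sqrt_mul hL, Real.sqrt_div hL]
  have h := Real.mul_self_sqrt hn.le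
  have h' : 0 < Real.sqrt n := Real.sqrt_pos.2 hn
  field_simp
  rw [sq, h]

theorem NoiseControlled.abs_average_le {T : ℕ} {η : ℕ → ℝ} (h : NoiseControlled T η) {s n : ℕ}
    (hs : 1 ≤ s) (hn : 1 ≤ n) (hT : s + n ≤ T + 1) :
    |(∑ u ∈ Finset.Ico s (s + n), η u) / n| ≤ Real.sqrt (12 * Real.log T / n) := by
  have hn' : (0 : ℝ) < n := by exact_mod_cast hn
  rw [abs_div, abs_of_pos hn', ← sqrt_mul_div_eq_sqrt_div
    (mul_nonneg (by norm_num) (Real.log_natCast_nonneg T)) hn']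
  gcongr
  exact h s n hs hn hT

/-- A window in which the gap is constant: the average reward. -/
theorem average_reward_eq {η D : ℕ → ℝ} {s n : ℕ} {d : ℝ} (hn : 1 ≤ n)
    (hD : ∀ u ∈ Finset.Ico s (s + n), D u = d) :
    (∑ u ∈ Finset.Ico s (s + n), (1 - D u + η u)) / n =
      1 - d + (∑ u ∈ Finset.Ico s (s + n), η u) / n := by
  have hn' : (n : ℝ) ≠ 0 := by
    have : n ≠ 0 := by omega
    exact_mod_cast this
  rw [Finset.sum_add_distrib, Finset.sum_congr rfl fun u hu => by rw [hD u hu]]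
  rw [Finset.sum_const, Nat.card_Ico, Nat.add_sub_cancel_left, nsmul_eq_mul]
  field_simp

/-- An arm of constant gap below `δ` is not withdrawn. -/
theorem not_withdraws_of_gap_lt {T : ℕ} {δ d : ℝ} {η D : ℕ → ℝ} {b t : ℕ}
    (hη : NoiseControlled T η) (hb : 1 ≤ b) (ht : t ≤ T)
    (hD : ∀ u, b ≤ u → u ≤ t → D u = d) (hd : d < δ) : ¬ Withdraws T δ η D b t := by
  rintro ⟨j, hj, hw⟩
  have h2 : 0 < 2 ^ j := by positivity
  obtain ⟨s, hs⟩ : ∃ s, s + 2 ^ j = t + 1 := ⟨t + 1 - 2 ^ j, by omega⟩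
  have e : t + 1 - 2 ^ j = s := by omega
  rw [e, ← hs] at hw
  have h3 := average_reward_eq (η := η) (s := s) (n := 2 ^ j) (D := D) (d := d) h2
    (fun u hu => by rw [Finset.mem_Ico] at hu; exact hD u (by omega) (by omega))
  have h4 := hη.abs_average_le (s := s) (n := 2 ^ j) (by omega) h2 (by omega)
  push_cast at h3 h4
  rw [h3] at hw
  -- The confidence bonus absorbs the noise, so the index is at least `1 - d > 1 - δ`.
  have := neg_abs_le ((∑ u ∈ Finset.Ico s (s + 2 ^ j), η u) / 2 ^ j)
  linarith

/-- An arm whose gap has been a constant above `2 δ` for sufficiently long is withdrawn. -/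
theorem withdraws_of_gap_gt {T : ℕ} {δ d : ℝ} {η D : ℕ → ℝ} {b e j : ℕ}
    (hη : NoiseControlled T η) (he : 1 ≤ e) (hb : b ≤ e) (hT : e + 2 ^ j ≤ T + 1)
    (hD : ∀ u, e ≤ u → u < e + 2 ^ j → D u = d) (hd : 2 * δ < d)
    (hdj : 4 * Real.sqrt (12 * Real.log T / 2 ^ j) ≤ d) :
    Withdraws T δ η D b (e + 2 ^ j - 1) := by
  have h2 : 0 < 2 ^ j := by positivity
  have h1 : e + 2 ^ j - 1 + 1 = e + 2 ^ j := by omega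
  refine ⟨j, by omega, ?_⟩
  rw [h1, Nat.add_sub_cancel]
  have h3 := average_reward_eq (η := η) (s := e) (n := 2 ^ j) (D := D) (d := d) h2
    (fun u hu => by rw [Finset.mem_Ico] at hu; exact hD u hu.1 hu.2)
  have h4 := hη.abs_average_le (s := e) (n := 2 ^ j) he h2 hT
  push_cast at h3 h4
  rw [h3]
  -- The noise and the bonus are each at most `d / 4`, so the index is at most `1 - d / 2 < 1 - δ`.
  have := le_abs_self ((∑ u ∈ Finset.Ico e (e + 2 ^ j), η u) / 2 ^ j)
  linarith

/-- A power of two that is at least `L` and at most `1 + 2 L`. -/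
theorem exists_two_pow_between {L : ℝ} (hL : 0 ≤ L) :
    ∃ j : ℕ, L ≤ 2 ^ j ∧ (2 : ℝ) ^ j ≤ 1 + 2 * L := by
  rcases le_or_gt L 1 with h | h
  · exact ⟨0, by simpa using h, by simp; linarith⟩
  · obtain ⟨j, h1, h2⟩ := exists_nat_pow_near h.le (one_lt_two : (1 : ℝ) < 2)
    exact ⟨j + 1, h2.le, by rw [pow_succ]; linarith⟩

theorem four_mul_sqrt_div_le {L d n : ℝ} (hd : 0 < d) (hn : 0 < n)
    (h : 16 * L / d ^ 2 ≤ n) : 4 * Real.sqrt (L / n) ≤ d := by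
  have h1 : Real.sqrt (L / n) ≤ d / 4 := by
    apply Real.sqrt_le_iff.2 ⟨by positivity, ?_⟩
    rw [div_le_iff₀ (by positivity)] at h
    rw [div_le_iff₀ hn]
    nlinarith
  linarith

/-! ### Pathwise regret bound -/

namespace IsTrajectory

variable {T : ℕ} {δ : ℝ} {x η ρ : ℕ → ℝ} {I B : ℕ → ℕ} {D : ℕ → ℝ}

theorem start_mem (h : IsTrajectory T δ x η ρ I B D) {t : ℕ} (ht : 1 ≤ t) (htT : t ≤ T) :
    1 ≤ B t ∧ B t ≤ t := by
  induction t, ht using Nat.le_induction with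
  | base => simp [h.start_one]
  | succ t ht ih =>
    have ih := ih (by omega)
    by_cases hw : Withdraws T δ η D (B t) t
    · have := (h.withdraw t ht (by omega) hw).2.1
      omega
    · have := (h.keep t ht (by omega) hw).2.1
      omega

theorem start_succ (h : IsTrajectory T δ x η ρ I B D) {t : ℕ} (ht : 1 ≤ t) (htT : t < T) :
    (B (t + 1) = t + 1 ∧ I (t + 1) = I t + 1) ∨ (B (t + 1) = B t ∧ I (t + 1) = I t) := by
  by_cases hw : Withdraws T δ η D (B t) t
  · have := h.withdraw t ht htT hw
    exact Or.inl ⟨this.2.1, this.1⟩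
  · have := h.keep t ht htT hw
    exact Or.inr ⟨this.2.1, this.1⟩

theorem start_mono (h : IsTrajectory T δ x η ρ I B D) {s t : ℕ} (hs : 1 ≤ s) (hst : s ≤ t)
    (htT : t ≤ T) : B s ≤ B t := by
  induction t, hst using Nat.le_induction with
  | base => exact le_rfl
  | succ t ht ih =>
    have ih := ih (by omega)
    have := h.start_succ (t := t) (by omega) (by omega)
    have := h.start_mem (t := t) (by omega) (by omega)
    omega

theorem idx_lt (h : IsTrajectory T δ x η ρ I B D) {t : ℕ} (ht : 1 ≤ t) (htT : t ≤ T) :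
    I t < t := by
  induction t, ht using Nat.le_induction with
  | base => simp [h.idx_one]
  | succ t ht ih =>
    have := h.start_succ (t := t) (by omega) (by omega)
    have := ih (by omega)
    omega

theorem idx_mono (h : IsTrajectory T δ x η ρ I B D) {s t : ℕ} (hs : 1 ≤ s) (hst : s ≤ t)
    (htT : t ≤ T) : I s ≤ I t := by
  induction t, hst using Nat.le_induction with
  | base => exact le_rfl
  | succ t ht ih =>
    have ih := ih (by omega)
    have := h.start_succ (t := t) (by omega) (by omega)
    omega

theorem block (h : IsTrajectory T δ x η ρ I B D) {s t : ℕ} (ht : 1 ≤ t) (htT : t ≤ T)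
    (hs : B t ≤ s) (hst : s ≤ t) : I s = I t ∧ B s = B t := by
  induction t, ht using Nat.le_induction generalizing s with
  | base =>
    obtain rfl : s = 1 := by have := h.start_one; omega
    simp
  | succ t ht ih =>
    rcases hst.eq_or_lt with rfl | hlt
    · simp
    · rcases h.start_succ (t := t) ht (by omega) with h1 | h1
      · omega
      · rw [h1.1, h1.2]
        exact ih (by omega) (by omega) (by omega)

theorem gap_eq (h : IsTrajectory T δ x η ρ I B D) {t : ℕ} (ht : 1 ≤ t) (htT : t ≤ T) :
    D t = x (I t) + ∑ s ∈ Finset.Ico (B t) t, ρ s := by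
  induction t, ht using Nat.le_induction with
  | base => simp [h.start_one, h.idx_one, h.gap_one]
  | succ t ht ih =>
    have ih := ih (by omega)
    by_cases hw : Withdraws T δ η D (B t) t
    · obtain ⟨h1, h2, h3⟩ := h.withdraw t ht (by omega) hw
      simp [h1, h2, h3]
    · obtain ⟨h1, h2, h3⟩ := h.keep t ht (by omega) hw
      rw [h1, h2, h3, ih, Finset.sum_Ico_succ_top (h.start_mem ht (by omega)).2]
      ring

theorem gap_eq_of_start_eq (h : IsTrajectory T δ x η ρ I B D) {t : ℕ} (ht : 1 ≤ t) (htT : t ≤ T)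
    (hb : B t = t) : D t = x (I t) := by
  rw [h.gap_eq ht htT, hb]
  simp

theorem gap_nonneg (h : IsTrajectory T δ x η ρ I B D) (hx : ∀ i, 0 ≤ x i)
    (hρ : ∀ t ∈ Finset.Ico 1 T, 0 ≤ ρ t) {t : ℕ} (ht : 1 ≤ t) (htT : t ≤ T) : 0 ≤ D t := by
  rw [h.gap_eq ht htT]
  refine add_nonneg (hx _) (Finset.sum_nonneg fun s hs => hρ s ?_)
  have := h.start_mem ht htT
  simp at hs ⊢
  omega

theorem gap_le (h : IsTrajectory T δ x η ρ I B D) (hx : ∀ i, x i ≤ 1)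
    (hρ : ∀ t ∈ Finset.Ico 1 T, 0 ≤ ρ t) {t : ℕ} (ht : 1 ≤ t) (htT : t ≤ T) :
    D t ≤ 1 + ∑ s ∈ Finset.Ico 1 T, ρ s := by
  rw [h.gap_eq ht htT]
  refine add_le_add (hx _) (Finset.sum_le_sum_of_subset_of_nonneg ?_ fun s hs _ => hρ s hs)
  have := h.start_mem ht htT
  exact Finset.Ico_subset_Ico this.1 htT

/-- Makes `I` injective on block starts: if the arm had been kept at `t`, the block would have
started before `t`. -/
theorem start_injOn (h : IsTrajectory T δ x η ρ I B D) {s t : ℕ} (hs : 1 ≤ s) (hst : s < t)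
    (htT : t ≤ T) (hb : B t = t) : I s < I t := by
  obtain ⟨t, rfl⟩ : ∃ u, t = u + 1 := ⟨t - 1, by omega⟩
  have h1 := h.idx_mono hs (show s ≤ t by omega) (by omega)
  have h2 := h.start_mem (t := t) (by omega) (by omega)
  rcases h.start_succ (t := t) (by omega) (by omega) with h3 | h3 <;> omega

/-- Every arm before the current one was withdrawn. -/
theorem exists_withdraws (h : IsTrajectory T δ x η ρ I B D) {t i : ℕ} (ht : 1 ≤ t) (htT : t ≤ T)
    (hi : i < I t) : ∃ s, 1 ≤ s ∧ s < t ∧ I s = i ∧ Withdraws T δ η D (B s) s := by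
  induction t, ht using Nat.le_induction with
  | base => simp [h.idx_one] at hi
  | succ t ht ih =>
    by_cases hlt : i < I t
    · obtain ⟨s, h1, h2, h3⟩ := ih (by omega) hlt
      exact ⟨s, h1, by omega, h3⟩
    · by_cases hw : Withdraws T δ η D (B t) t
      · have := (h.withdraw t ht (by omega) hw).1
        exact ⟨t, ht, by omega, by omega, hw⟩
      · have := (h.keep t ht (by omega) hw).1
        omega

/-- A good arm is only withdrawn after it has rotted. -/
theorem goodCount_le (h : IsTrajectory T δ x η ρ I B D) (hη : NoiseControlled T η)
    {t : ℕ} (ht : 1 ≤ t) (htT : t ≤ T) :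
    goodCount δ x (I t) ≤ ((Finset.Ico 1 T).filter fun s => ρ s ≠ 0).card := by
  -- Each withdrawn good arm is charged to a rotting round in its own block; distinct arms have
  -- distinct blocks.
  refine le_trans (Finset.card_le_card (t := ((Finset.Ico 1 T).filter fun s => ρ s ≠ 0).image I)
    fun i hi => ?_) Finset.card_image_le
  rw [Finset.mem_filter, Finset.mem_range] at hi
  obtain ⟨s, h1, h2, h3, hw⟩ := h.exists_withdraws ht htT hi.1
  by_contra hno
  have hb := h.start_mem h1 (by omega)
  refine not_withdraws_of_gap_lt (d := x i) hη hb.1 (show s ≤ T by omega) (fun u hu1 hu2 => ?_)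
    hi.2 hw
  have hbl := h.block h1 (by omega) hu1 hu2
  rw [h.gap_eq (by omega) (by omega), hbl.1, hbl.2, h3, Finset.sum_eq_zero, add_zero]
  intro v hv
  rw [Finset.mem_Ico] at hv
  by_contra hne
  refine hno (Finset.mem_image.2 ⟨v, Finset.mem_filter.2 ⟨by simp; omega, hne⟩, ?_⟩)
  rw [(h.block h1 (by omega) hv.1 (by omega)).1, h3]

/-- The rounds in which a new arm is taken or the current one has just rotted. -/
def IsBreak (B : ℕ → ℕ) (ρ : ℕ → ℝ) (t : ℕ) : Prop := B t = t ∨ ρ (t - 1) ≠ 0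

/-- The beginning of the segment of constant gap. -/
theorem exists_break (h : IsTrajectory T δ x η ρ I B D) {t : ℕ} (ht : 1 ≤ t) (htT : t ≤ T) :
    ∃ e, 1 ≤ e ∧ e ≤ t ∧ B t ≤ e ∧ IsBreak B ρ e ∧ ∀ u, e ≤ u → u ≤ t → D u = D e := by
  induction t, ht using Nat.le_induction with
  | base =>
    refine ⟨1, le_rfl, le_rfl, h.start_one.le, Or.inl h.start_one, fun u h1 h2 => ?_⟩
    rw [show u = 1 by omega]
  | succ t ht ih =>
    by_cases hbr : IsBreak B ρ (t + 1)
    · refine ⟨t + 1, by omega, le_rfl, (h.start_mem (by omega) htT).2, hbr, fun u h1 h2 => ?_⟩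
      rw [show u = t + 1 by omega]
    · obtain ⟨e, h1, h2, h3, h4, h5⟩ := ih (by omega)
      simp only [IsBreak, Nat.add_sub_cancel, not_or, not_not] at hbr
      have hw : ¬ Withdraws T δ η D (B t) t := fun hw => hbr.1 (h.withdraw t ht (by omega) hw).2.1
      have hk := h.keep t ht (by omega) hw
      refine ⟨e, h1, by omega, by omega, h4, fun u hu1 hu2 => ?_⟩
      rcases hu2.eq_or_lt with rfl | hlt
      · rw [hk.2.2, hbr.2, add_zero, h5 t h2 le_rfl]
      · exact h5 u hu1 (by omega)

/-- A segment of constant gap above `2 δ` is short. -/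
theorem lt_of_segment (h : IsTrajectory T δ x η ρ I B D) (hη : NoiseControlled T η)
    {e t j : ℕ} (he : 1 ≤ e) (htT : t ≤ T) (hb : B t ≤ e)
    (hD : ∀ u, e ≤ u → u ≤ t → D u = D e) (hd : 2 * δ < D e)
    (hdj : 4 * Real.sqrt (12 * Real.log T / 2 ^ j) ≤ D e) : t < e + 2 ^ j := by
  by_contra! hle
  have h2 : 0 < 2 ^ j := by positivity
  have hbe : B (e + 2 ^ j - 1) ≤ e :=
    (h.start_mono (by omega) (by omega) htT).trans hb
  -- The window filling the first `2 ^ j` rounds of the segment forces a new block at `e + 2 ^ j ≤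
  -- t`, contrary to `B t ≤ e`.
  have hw := withdraws_of_gap_gt (b := B (e + 2 ^ j - 1)) hη he hbe (by omega)
    (fun u h1 h3 => hD u h1 (by omega)) hd hdj
  have h3 := (h.withdraw _ (by omega) (by omega) hw).2.1
  have h4 := h.start_mono (s := e + 2 ^ j - 1 + 1) (by omega) (by omega : _ ≤ t) htT
  omega

open Classical in
/-- Summation of the gaps segment by segment. -/
theorem sum_gap_le_breaks (h : IsTrajectory T δ x η ρ I B D) (hη : NoiseControlled T η)
    (hδ : 0 < δ) :
    ∑ t ∈ Finset.Icc 1 T, D t ≤ 2 * δ * T +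
      ∑ e ∈ (Finset.Icc 1 T).filter (fun e => IsBreak B ρ e ∧ 2 * δ < D e),
        (D e + 384 * Real.log T / D e) := by
  rw [← Finset.sum_filter_add_sum_filter_not (Finset.Icc 1 T) (fun t => 2 * δ < D t), add_comm]
  refine add_le_add ?_ ?_
  · refine (Finset.sum_le_card_nsmul _ _ (2 * δ) fun t ht => ?_).trans ?_
    · exact not_lt.1 (Finset.mem_filter.1 ht).2
    · rw [nsmul_eq_mul, mul_comm]
      have : ((Finset.Icc 1 T).filter fun t => ¬ 2 * δ < D t).card ≤ T := by
        simpa using Finset.card_filter_le (Finset.Icc 1 T) (fun t => ¬ 2 * δ < D t)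
      gcongr
  -- Rounds of large gap are grouped by the break `f t` at which their segment of constant gap
  -- begins.
  · choose! f hf1 hf2 hf3 hf4 hf5 using
      fun t (ht : t ∈ Finset.Icc 1 T) => h.exists_break (Finset.mem_Icc.1 ht).1
        (Finset.mem_Icc.1 ht).2
    have hmap : ∀ t ∈ (Finset.Icc 1 T).filter (fun t => 2 * δ < D t),
        f t ∈ (Finset.Icc 1 T).filter (fun e => IsBreak B ρ e ∧ 2 * δ < D e) := by
      intro t ht
      rw [Finset.mem_filter] at ht
      have h1 := hf5 t ht.1 t (hf2 t ht.1) le_rfl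
      have h2 := Finset.mem_Icc.1 ht.1
      have h3 := hf2 t ht.1
      have h4 := hf1 t ht.1
      exact Finset.mem_filter.2 ⟨Finset.mem_Icc.2 ⟨h4, by omega⟩, hf4 t ht.1, h1 ▸ ht.2⟩
    rw [← Finset.sum_fiberwise_of_maps_to hmap]
    refine Finset.sum_le_sum fun e he => ?_
    rw [Finset.mem_filter, Finset.mem_Icc] at he
    have hDe : 0 < D e := by linarith [he.2.2]
    -- With `L = 192 log T / d ^ 2` the radius is at most `d / 4`. Rounding to a power of two gives
    -- length at most `1 + 2 L`, hence cost `d + 384 log T / d`.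
    obtain ⟨j, hj1, hj2⟩ := exists_two_pow_between
      (L := 16 * (12 * Real.log T) / D e ^ 2) (by have := Real.log_natCast_nonneg T; positivity)
    have hdj := four_mul_sqrt_div_le hDe (by positivity) hj1
    set A := ((Finset.Icc 1 T).filter (fun t => 2 * δ < D t)).filter (fun t => f t = e) with hA
    have hmem : ∀ t ∈ A, t ∈ Finset.Icc 1 T ∧ f t = e := fun t ht => by
      rw [hA, Finset.mem_filter, Finset.mem_filter] at ht
      exact ⟨ht.1.1, ht.2⟩
    have hcard : A.card ≤ 2 ^ j := by
      have : A ⊆ Finset.Ico e (e + 2 ^ j) := by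
        intro t ht
        obtain ⟨ht1, rfl⟩ := hmem t ht
        have := h.lt_of_segment hη (hf1 t ht1) (Finset.mem_Icc.1 ht1).2 (hf3 t ht1) (hf5 t ht1)
          he.2.2 hdj
        exact Finset.mem_Ico.2 ⟨hf2 t ht1, this⟩
      simpa using Finset.card_le_card this
    have hcard' : (A.card : ℝ) ≤ 2 ^ j := by exact_mod_cast hcard
    have hsum : ∑ t ∈ A, D t = A.card * D e := by
      rw [← nsmul_eq_mul]
      refine Finset.sum_eq_card_nsmul fun t ht => ?_
      obtain ⟨ht1, rfl⟩ := hmem t ht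
      exact hf5 t ht1 t (hf2 t ht1) le_rfl
    rw [hsum]
    calc (A.card : ℝ) * D e ≤ (1 + 2 * (16 * (12 * Real.log T) / D e ^ 2)) * D e := by
          gcongr
          exact hcard'.trans hj2
      _ = D e + 384 * Real.log T / D e := by
          field_simp
          ring

/-- The contribution of the segments at whose beginning a new arm was taken. -/
theorem sum_new_le (h : IsTrajectory T δ x η ρ I B D) (hη : NoiseControlled T η) {S : ℕ}
    (hS : 1 + ((Finset.Ico 1 T).filter fun s => ρ s ≠ 0).card ≤ S)
    {g : ℝ → ℝ} (hg : ∀ y, 0 ≤ g y) :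
    ∑ e ∈ (Finset.Icc 1 T).filter (fun e => B e = e), g (D e) ≤
      ∑ i ∈ Finset.range T, if goodCount δ x i < S then g (x i) else 0 := by
  have hinj : Set.InjOn I ((Finset.Icc 1 T).filter (fun e => B e = e)) := by
    intro s hs t ht hst
    simp only [Finset.coe_filter, Finset.mem_Icc, Set.mem_ofPred_eq] at hs ht
    rcases lt_trichotomy s t with hlt | rfl | hlt
    · have := h.start_injOn hs.1.1 hlt ht.1.2 ht.2
      omega
    · rfl
    · have := h.start_injOn ht.1.1 hlt hs.1.2 hs.2
      omega
  -- The condition on `goodCount` holds for every arm taken, strictly thanks to the `1 +` in `hS`.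
  -- Inserting it allows enlarging the sum to all `i < T`, with a condition that depends only on the
  -- arms before `i`.
  calc ∑ e ∈ (Finset.Icc 1 T).filter (fun e => B e = e), g (D e)
      = ∑ e ∈ (Finset.Icc 1 T).filter (fun e => B e = e),
          (fun i => if goodCount δ x i < S then g (x i) else 0) (I e) := by
        refine Finset.sum_congr rfl fun e he => ?_
        rw [Finset.mem_filter, Finset.mem_Icc] at he
        have := h.goodCount_le hη he.1.1 he.1.2
        simp only
        rw [if_pos (by omega), h.gap_eq_of_start_eq he.1.1 he.1.2 he.2]
    _ = ∑ i ∈ ((Finset.Icc 1 T).filter (fun e => B e = e)).image I,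
          if goodCount δ x i < S then g (x i) else 0 :=
        (Finset.sum_image (f := fun i => if goodCount δ x i < S then g (x i) else 0) hinj).symm
    _ ≤ _ := by
        refine Finset.sum_le_sum_of_subset_of_nonneg (fun i hi => ?_) fun i _ _ => ?_
        · obtain ⟨e, he, rfl⟩ := Finset.mem_image.1 hi
          rw [Finset.mem_filter, Finset.mem_Icc] at he
          have := h.idx_lt he.1.1 he.1.2
          exact Finset.mem_range.2 (by omega)
        · split_ifs
          · exact hg _
          · exact le_rfl

/-- An arm is pulled at most once with a gap above the largest confidence radius. -/
theorem sum_large_gap_le (h : IsTrajectory T δ x η ρ I B D) (hη : NoiseControlled T η)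
    (hx : ∀ i, x i ≤ 1) (hρ : ∀ t ∈ Finset.Ico 1 T, 0 ≤ ρ t) (E : Finset ℕ)
    (hE : ∀ e ∈ E, 1 ≤ e ∧ e ≤ T ∧ 2 * δ < D e ∧ 4 * Real.sqrt (12 * Real.log T) ≤ D e) :
    ∑ e ∈ E, D e ≤ E.card + ∑ s ∈ Finset.Ico 1 T, ρ s := by
  have hdisj : Set.PairwiseDisjoint (E : Set ℕ) fun e => Finset.Ico (B e) e := by
    have key : ∀ e ∈ E, ∀ e' ∈ E, e < e' →
        Disjoint (Finset.Ico (B e) e) (Finset.Ico (B e') e') := by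
      intro e he e' he' hlt
      obtain ⟨h1, h2, h3, h4⟩ := hE e he
      obtain ⟨h1', h2', -, -⟩ := hE e' he'
      -- For `j = 0` the single round `e` already forces withdrawal, so later members of `E` belong
      -- to later blocks.
      have hw := withdraws_of_gap_gt (b := B e) (e := e) (j := 0) (d := D e) hη h1
        (h.start_mem h1 h2).2 (by omega) (fun u hu1 hu2 => by rw [show u = e by omega]) h3
        (by simpa using h4)
      have h5 := (h.withdraw e h1 (by omega) (by simpa using hw)).2.1
      have h6 := h.start_mono (s := e + 1) (by omega) (show e + 1 ≤ e' by omega) h2'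
      rw [Finset.disjoint_left]
      intro v hv hv'
      rw [Finset.mem_Ico] at hv hv'
      omega
    intro e he e' he' hne
    rcases Nat.lt_or_gt_of_ne hne with hlt | hlt
    · exact key e he e' he' hlt
    · exact (key e' he' e he hlt).symm
  calc ∑ e ∈ E, D e ≤ ∑ e ∈ E, (1 + ∑ s ∈ Finset.Ico (B e) e, ρ s) := by
        refine Finset.sum_le_sum fun e he => ?_
        obtain ⟨h1, h2, -, -⟩ := hE e he
        rw [h.gap_eq h1 h2]
        linarith [hx (I e)]
    _ = E.card + ∑ s ∈ E.biUnion fun e => Finset.Ico (B e) e, ρ s := by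
        rw [Finset.sum_add_distrib, Finset.sum_biUnion hdisj]
        simp
    _ ≤ _ := by
        refine add_le_add le_rfl
          (Finset.sum_le_sum_of_subset_of_nonneg (fun s hs => ?_) fun s hs _ => hρ s hs)
        obtain ⟨e, he, hs⟩ := Finset.mem_biUnion.1 hs
        obtain ⟨h1, h2, -, -⟩ := hE e he
        have := h.start_mem h1 h2
        simp at hs ⊢
        omega

/-- The contribution of the segments that begin after a rotting. -/
theorem sum_rotted_le (h : IsTrajectory T δ x η ρ I B D) (hη : NoiseControlled T η)
    (hδ : 0 < δ) {S : ℕ} (hS : 1 + ((Finset.Ico 1 T).filter fun s => ρ s ≠ 0).card ≤ S)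
    (hx : ∀ i, x i ≤ 1) (hρ : ∀ t ∈ Finset.Ico 1 T, 0 ≤ ρ t) (E : Finset ℕ)
    (hE : ∀ e ∈ E, 1 < e ∧ e ≤ T ∧ ρ (e - 1) ≠ 0 ∧ 2 * δ < D e) :
    ∑ e ∈ E, (D e + 384 * Real.log T / D e) ≤
      S * (1 + 4 * Real.sqrt (12 * Real.log T) + 192 * Real.log T / δ) +
        ∑ s ∈ Finset.Ico 1 T, ρ s := by
  have hcard : E.card ≤ S := by
    have : E.card ≤ ((Finset.Ico 1 T).filter fun s => ρ s ≠ 0).card := by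
      -- Since `1 < e`, the shift `e ↦ e - 1` is not truncated and sends `E` injectively into the
      -- rotting rounds.
      refine Finset.card_le_card_of_injOn (fun e => e - 1) (fun e he => ?_) fun e he e' he' hee => ?_
      · have := hE e he
        simp only [Finset.coe_filter, Finset.mem_Ico, Set.mem_ofPred_eq]
        exact ⟨by omega, this.2.2.1⟩
      · have := hE e he
        have := hE e' he'
        simp only at hee
        omega
    omega
  have hcard' : (E.card : ℝ) ≤ S := by exact_mod_cast hcard
  set M := 4 * Real.sqrt (12 * Real.log T)
  have hM : 0 ≤ M := by positivity
  have hlog := Real.log_natCast_nonneg T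
  have h1 : ∑ e ∈ E, 384 * Real.log T / D e ≤ S * (192 * Real.log T / δ) := by
    refine (Finset.sum_le_card_nsmul _ _ (192 * Real.log T / δ) fun e he => ?_).trans ?_
    · have := (hE e he).2.2.2
      rw [div_le_div_iff₀ (by linarith) hδ]
      nlinarith
    · rw [nsmul_eq_mul]
      gcongr
  -- Gaps below `M` contribute at most `S * M`; the larger ones are controlled by the rotting
  -- budget.
  have h2 : ∑ e ∈ E, D e ≤ S * (1 + M) + ∑ s ∈ Finset.Ico 1 T, ρ s := by
    rw [← Finset.sum_filter_add_sum_filter_not E (fun e => M ≤ D e)]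
    have h3 := h.sum_large_gap_le hη hx hρ (E.filter fun e => M ≤ D e) (fun e he => by
      rw [Finset.mem_filter] at he
      have := hE e he.1
      exact ⟨by omega, this.2.1, this.2.2.2, he.2⟩)
    have h4 : ∑ e ∈ E.filter (fun e => ¬ M ≤ D e), D e ≤ S * M := by
      refine (Finset.sum_le_card_nsmul _ _ M fun e he => ?_).trans ?_
      · exact (not_le.1 (Finset.mem_filter.1 he).2).le
      · rw [nsmul_eq_mul]
        gcongr
        exact (Finset.card_filter_le _ _).trans hcard
    have h5 : ((E.filter fun e => M ≤ D e).card : ℝ) ≤ S := by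
      exact_mod_cast (Finset.card_filter_le _ _).trans hcard
    linarith
  rw [Finset.sum_add_distrib]
  linarith

/-- The bound for the regret along a trajectory with controlled noise. -/
theorem sum_gap_le (h : IsTrajectory T δ x η ρ I B D) (hη : NoiseControlled T η) (hT : 2 ≤ T)
    (hδ : 0 < δ) {S : ℕ} (hS : 1 + ((Finset.Ico 1 T).filter fun s => ρ s ≠ 0).card ≤ S)
    (hx : ∀ i, x i ≤ 1) (hρ : ∀ t ∈ Finset.Ico 1 T, 0 ≤ ρ t) :
    ∑ t ∈ Finset.Icc 1 T, D t ≤ 2 * δ * T +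
      386 * Real.log T * ∑ i ∈ Finset.range T, (if goodCount δ x i < S then
        truncInv δ (x i) else 0) +
      (S * (1 + 4 * Real.sqrt (12 * Real.log T) + 192 * Real.log T / δ) +
        ∑ s ∈ Finset.Ico 1 T, ρ s) := by
  classical
  have hlog : 1 / 2 ≤ Real.log T := by
    have h1 : Real.log 2 ≤ Real.log T := Real.log_le_log (by norm_num) (by exact_mod_cast hT)
    linarith [Real.log_two_gt_d9]
  refine (h.sum_gap_le_breaks hη hδ).trans ?_
  rw [add_assoc]
  gcongr
  rw [← Finset.sum_filter_add_sum_filter_not _ (fun e => B e = e)]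
  refine add_le_add ?_ ?_
  · have hnew := h.sum_new_le hη hS (truncInv_nonneg hδ)
    refine le_trans ?_ (mul_le_mul_of_nonneg_left hnew (by linarith))
    rw [Finset.mul_sum]
    calc _ ≤ ∑ e ∈ ((Finset.Icc 1 T).filter (fun e => IsBreak B ρ e ∧ 2 * δ < D e)).filter
            (fun e => B e = e), 386 * Real.log T * truncInv δ (D e) := by
          refine Finset.sum_le_sum fun e he => ?_
          simp only [Finset.mem_filter, Finset.mem_Icc] at he
          have hd : 0 < D e := by linarith [he.1.2.2]
          have hd1 : D e ≤ 1 := by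
            rw [h.gap_eq_of_start_eq he.1.1.1 he.1.1.2 he.2]
            exact hx _
          rw [truncInv, if_pos he.1.2.2, ← div_eq_mul_inv]
          -- Here `D e ≤ 1 ≤ 2 log T`, so the linear term adds 2 to the constant 384.
          have : D e ≤ 2 * Real.log T / D e := by
            rw [le_div_iff₀ hd]
            nlinarith
          calc D e + 384 * Real.log T / D e
              ≤ 2 * Real.log T / D e + 384 * Real.log T / D e := by gcongr
            _ = 386 * Real.log T / D e := by ring
      _ ≤ _ := by
          refine Finset.sum_le_sum_of_subset_of_nonneg (fun e he => ?_) fun e _ _ => ?_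
          · simp only [Finset.mem_filter] at he ⊢
            exact ⟨he.1.1, he.2⟩
          · exact mul_nonneg (by linarith) (truncInv_nonneg hδ _)
  · refine h.sum_rotted_le hη hδ hS hx hρ _ fun e he => ?_
    rw [Finset.mem_filter, Finset.mem_filter, Finset.mem_Icc] at he
    have hne : e ≠ 1 := by
      rintro rfl
      exact he.2 h.start_one
    exact ⟨by omega, he.1.1.2, he.1.2.1.resolve_left he.2, he.1.2.2⟩

end IsTrajectory

/-! ### Measurability of the trajectory -/

section Measurability

variable {Ω : Type*} {mΩ : MeasurableSpace Ω}

theorem measurableSet_withdraws {T t : ℕ} {δ : ℝ} {η D : ℕ → Ω → ℝ} {B : Ω → ℕ}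
    (hB : Measurable B) (hB1 : ∀ ω, 1 ≤ B ω) (hη : ∀ u, 1 ≤ u → u ≤ t → Measurable (η u))
    (hD : ∀ u, 1 ≤ u → u ≤ t → Measurable (D u)) :
    MeasurableSet {ω | Withdraws T δ (fun u => η u ω) (fun u => D u ω) (B ω) t} := by
  simp only [Withdraws, Set.ofPred_exists]
  refine MeasurableSet.iUnion fun j => ?_
  by_cases hj : 2 ^ j ≤ t
  · rw [Set.ofPred_and]
    refine MeasurableSet.inter
      (measurableSet_le (hB.add_const _) measurable_const)
      (measurableSet_lt (((Finset.measurable_sum _ fun u hu => ?_).div_const _).add_const _)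
        measurable_const)
    rw [Finset.mem_Ico] at hu
    exact ((measurable_const.sub (hD u (by omega) (by omega))).add (hη u (by omega) (by omega)))
  -- Blocks start at round 1 or later, so no window longer than `t` fits.
  · convert MeasurableSet.empty
    rw [Set.eq_empty_iff_forall_notMem]
    rintro ω ⟨h, -⟩
    have := hB1 ω
    omega

theorem measurable_eval_nat {x : ℕ → Ω → ℝ} (hx : ∀ i, Measurable (x i)) {N : Ω → ℕ}
    (hN : Measurable N) : Measurable fun ω => x (N ω) ω :=
  (measurable_from_prod_countable_right (f := fun p : ℕ × Ω => x p.1 p.2) hx).comp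
    (hN.prodMk measurable_id)

/-- The induction is strong because the withdrawal event of a round involves the gaps of all earlier
rounds in the window. -/
theorem measurable_trajectory {T : ℕ} {δ : ℝ} {x η ρ : ℕ → Ω → ℝ} {I B : ℕ → Ω → ℕ}
    {D : ℕ → Ω → ℝ}
    (h : ∀ ω, IsTrajectory T δ (fun i => x i ω) (fun t => η t ω) (fun t => ρ t ω)
      (fun t => I t ω) (fun t => B t ω) (fun t => D t ω))
    (hx : ∀ i, Measurable (x i)) (hη : ∀ t ∈ Finset.Icc 1 T, Measurable (η t))
    (hρ : ∀ t ∈ Finset.Ico 1 T, Measurable (ρ t)) {t : ℕ} (ht : 1 ≤ t) (htT : t ≤ T) :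
    Measurable (I t) ∧ Measurable (B t) ∧ Measurable (D t) := by
  induction t using Nat.strong_induction_on with
  | _ t ih =>
    rcases ht.eq_or_lt with rfl | hlt
    · refine ⟨?_, ?_, ?_⟩
      · rw [show I 1 = fun _ => 0 from funext fun ω => (h ω).idx_one]
        exact measurable_const
      · rw [show B 1 = fun _ => 1 from funext fun ω => (h ω).start_one]
        exact measurable_const
      · rw [show D 1 = x 0 from funext fun ω => (h ω).gap_one]
        exact hx 0
    · obtain ⟨t, rfl⟩ : ∃ u, t = u + 1 := ⟨t - 1, by omega⟩
      obtain ⟨h1, h2, h3⟩ := ih t (by omega) (by omega) (by omega)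
      have hW := measurableSet_withdraws (T := T) (t := t) (δ := δ) (η := η) (D := D) h2
        (fun ω => ((h ω).start_mem (by omega) (by omega)).1)
        (fun u hu1 hu2 => hη u (Finset.mem_Icc.2 ⟨hu1, by omega⟩))
        (fun u hu1 hu2 => (ih u (by omega) hu1 (by omega)).2.2)
      have hw := fun ω => (h ω).withdraw t (by omega) (by omega)
      have hk := fun ω => (h ω).keep t (by omega) (by omega)
      refine ⟨?_, ?_, ?_⟩
      · have hm := @Measurable.ite _ _ _ _ _ _ _ (Classical.decPred _) hW (h1.add_const 1) h1
        convert hm using 1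
        funext ω
        split_ifs with hc
        · exact (hw ω hc).1
        · exact (hk ω hc).1
      · have hm := @Measurable.ite _ _ _ _ _ _ _ (Classical.decPred _) hW (measurable_const (a := t + 1)) h2
        convert hm using 1
        funext ω
        split_ifs with hc
        · exact (hw ω hc).2.1
        · exact (hk ω hc).2.1
      · have hm := @Measurable.ite _ _ _ _ _ _ _ (Classical.decPred _) hW (measurable_eval_nat hx (h1.add_const 1))
          (h3.add (hρ t (Finset.mem_Ico.2 ⟨by omega, by omega⟩)))
        convert hm using 1
        funext ω
        split_ifs with hc
        · exact (hw ω hc).2.2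
        · exact (hk ω hc).2.2

end Measurability

/-! ### Concentration of the noise -/

section Concentration

variable {Ω : Type*} {mΩ : MeasurableSpace Ω} {P : Measure Ω} [IsProbabilityMeasure P]

/-- Adding a conditionally sub-Gaussian variable to a sub-Gaussian one. -/
theorem hasSubgaussianMGF_add_of_isCondSubGaussian {𝓖 : MeasurableSpace Ω} (h𝓖 : 𝓖 ≤ mΩ)
    {X Y : Ω → ℝ} {c : NNReal} (hXm : Measurable[𝓖] X)
    (hX : HasSubgaussianMGF X c P) (hY : IsCondSubGaussian P 𝓖 Y) :
    HasSubgaussianMGF (fun ω => X ω + Y ω) (c + 1) P := by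
  -- Exponential moments at `2 l` put both factors in `L²`, so their product is integrable and the
  -- conditional expectation may be pulled out.
  have hX2 : ∀ l : ℝ, MemLp (fun ω => Real.exp (l * X ω)) 2 P := fun l => by
    rw [memLp_two_iff_integrable_sq (hX.integrable_exp_mul l).aestronglyMeasurable]
    refine (hX.integrable_exp_mul (2 * l)).congr (ae_of_all _ fun ω => ?_)
    simp only
    rw [← Real.exp_nat_mul]
    congr 1
    push_cast
    ring
  have hY2 : ∀ l : ℝ, MemLp (fun ω => Real.exp (l * Y ω)) 2 P := fun l => by
    rw [memLp_two_iff_integrable_sq (hY l).1.aestronglyMeasurable]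
    refine (hY (2 * l)).1.congr (ae_of_all _ fun ω => ?_)
    simp only
    rw [← Real.exp_nat_mul]
    congr 1
    push_cast
    ring
  have hmul : ∀ l : ℝ, (fun ω => Real.exp (l * (X ω + Y ω))) =
      (fun ω => Real.exp (l * X ω)) * fun ω => Real.exp (l * Y ω) := fun l => by
    funext ω
    rw [Pi.mul_apply, ← Real.exp_add, mul_add]
  have hint : ∀ l : ℝ, Integrable
      ((fun ω => Real.exp (l * X ω)) * fun ω => Real.exp (l * Y ω)) P :=
    fun l => (hX2 l).integrable_mul (hY2 l)
  refine ⟨fun l => by rw [hmul]; exact hint l, fun l => ?_⟩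
  have hsm : StronglyMeasurable[𝓖] fun ω => Real.exp (l * X ω) :=
    (Real.measurable_exp.comp (hXm.const_mul l)).stronglyMeasurable
  have hce := condExp_mul_of_stronglyMeasurable_left hsm (hint l) (hY l).1
  calc mgf (fun ω => X ω + Y ω) P l
      = ∫ ω, ((fun ω => Real.exp (l * X ω)) * fun ω => Real.exp (l * Y ω)) ω ∂P := by
        rw [mgf, ← hmul]
    _ = ∫ ω, (P[(fun ω => Real.exp (l * X ω)) * fun ω => Real.exp (l * Y ω) | 𝓖]) ω ∂P :=
        (integral_condExp h𝓖).symm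
    _ ≤ ∫ ω, Real.exp (l * X ω) * Real.exp (l ^ 2 / 2) ∂P := by
        refine integral_mono_ae integrable_condExp
          ((hX.integrable_exp_mul l).mul_const _) ?_
        filter_upwards [hce, (hY l).2] with ω h1 h2
        rw [h1, Pi.mul_apply]
        exact mul_le_mul_of_nonneg_left h2 (Real.exp_nonneg _)
    _ = mgf X P l * Real.exp (l ^ 2 / 2) := by rw [integral_mul_const, mgf]
    _ ≤ Real.exp (c * l ^ 2 / 2) * Real.exp (l ^ 2 / 2) := by
        gcongr
        exact hX.mgf_le l
    _ = Real.exp (((c + 1 : NNReal) : ℝ) * l ^ 2 / 2) := by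
        rw [← Real.exp_add]
        congr 1
        push_cast
        ring

theorem hasSubgaussianMGF_noise_window {ℱ : Filtration ℕ mΩ} {T : ℕ} {η : ℕ → Ω → ℝ}
    (hm : ∀ t ∈ Finset.Icc 1 T, Measurable[ℱ t] (η t))
    (hη : ∀ t ∈ Finset.Icc 1 T, IsCondSubGaussian P (ℱ (t - 1)) (η t))
    {s : ℕ} (hs : 1 ≤ s) (n : ℕ) (hn : s + n ≤ T + 1) :
    HasSubgaussianMGF (fun ω => ∑ u ∈ Finset.Ico s (s + n), η u ω) (n : NNReal) P := by
  induction n with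
  | zero => simp
  | succ n ih =>
    have hmem : s + n ∈ Finset.Icc 1 T := Finset.mem_Icc.2 ⟨by omega, by omega⟩
    have := hasSubgaussianMGF_add_of_isCondSubGaussian (ℱ.le (s + n - 1))
      (X := fun ω => ∑ u ∈ Finset.Ico s (s + n), η u ω) (Y := η (s + n))
      (Finset.measurable_sum _ fun u hu => by
        rw [Finset.mem_Ico] at hu
        exact (hm u (Finset.mem_Icc.2 ⟨by omega, by omega⟩)).mono
          (ℱ.mono (by omega)) le_rfl)
      (ih (by omega)) (hη _ hmem)
    push_cast
    refine this.congr (ae_of_all _ fun ω => ?_)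
    simp only
    rw [← add_assoc, Finset.sum_Ico_succ_top (by omega)]

/-- The constant 12 in the radius makes the exponent `-ε ^ 2 / (2 n)` equal to `-6 log T`; the
factor 2 counts the two tails. -/
theorem measureReal_abs_window_gt {X : Ω → ℝ} {T n : ℕ} (hT : 1 ≤ T) (hn : 1 ≤ n)
    (hX : HasSubgaussianMGF X (n : NNReal) P) :
    P.real {ω | Real.sqrt (12 * Real.log T * n) < |X ω|} ≤ 2 * ((T : ℝ) ^ 6)⁻¹ := by
  set ε := Real.sqrt (12 * Real.log T * n)
  have hn' : (0 : ℝ) < n := by exact_mod_cast hn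
  have hT' : (0 : ℝ) < T := by exact_mod_cast hT
  have hε : 0 ≤ ε := Real.sqrt_nonneg _
  have hε2 : ε ^ 2 = 12 * Real.log T * n :=
    Real.sq_sqrt (mul_nonneg (mul_nonneg (by norm_num) (Real.log_natCast_nonneg T)) hn'.le)
  have hexp : Real.exp (-ε ^ 2 / (2 * ((n : NNReal) : ℝ))) = ((T : ℝ) ^ 6)⁻¹ := by
    rw [hε2, NNReal.coe_natCast,
      show -(12 * Real.log T * n) / (2 * (n : ℝ)) = -((6 : ℕ) * Real.log T) by
        field_simp
        push_cast
        ring,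
      Real.exp_neg, Real.exp_nat_mul, Real.exp_log hT']
  have h1 := hX.measure_ge_le hε
  have h2 := hX.neg.measure_ge_le hε
  rw [hexp] at h1 h2
  calc P.real {ω | ε < |X ω|} ≤ P.real ({ω | ε ≤ X ω} ∪ {ω | ε ≤ (-X) ω}) := by
        refine measureReal_mono fun ω hω => ?_
        rw [Set.mem_ofPred_eq] at hω
        rcases lt_abs.1 hω with h | h
        · exact Or.inl h.le
        · exact Or.inr h.le
    _ ≤ _ := (measureReal_union_le _ _).trans (by linarith)

/-- Outside an event of small probability the noise is controlled. -/
theorem exists_noise_event {ℱ : Filtration ℕ mΩ} {T : ℕ} (hT : 1 ≤ T) {η : ℕ → Ω → ℝ}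
    (hm : ∀ t ∈ Finset.Icc 1 T, Measurable[ℱ t] (η t))
    (hη : ∀ t ∈ Finset.Icc 1 T, IsCondSubGaussian P (ℱ (t - 1)) (η t)) :
    ∃ A : Set Ω, MeasurableSet A ∧ P.real A ≤ 2 * ((T : ℝ) ^ 4)⁻¹ ∧
      ∀ ω ∉ A, NoiseControlled T fun t => η t ω := by
  set W := ((Finset.Icc 1 T) ×ˢ (Finset.Icc 1 T)).filter fun p : ℕ × ℕ => p.1 + p.2 ≤ T + 1 with hW
  have hmem : ∀ p ∈ W, 1 ≤ p.1 ∧ 1 ≤ p.2 ∧ p.1 + p.2 ≤ T + 1 := fun p hp => by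
    simp only [hW, Finset.mem_filter, Finset.mem_product, Finset.mem_Icc] at hp
    omega
  have hcard : (W.card : ℝ) ≤ (T : ℝ) ^ 2 := by
    have : W.card ≤ T ^ 2 := by
      refine (Finset.card_filter_le _ _).trans ?_
      simp [sq]
    exact_mod_cast this
  refine ⟨⋃ p ∈ W, {ω | Real.sqrt (12 * Real.log T * (p.2 : ℕ)) <
    |∑ u ∈ Finset.Ico p.1 (p.1 + p.2), η u ω|}, ?_, ?_, ?_⟩
  · refine Finset.measurableSet_biUnion _ fun p hp => ?_
    have := hmem p hp
    refine measurableSet_lt measurable_const (Measurable.abs ?_)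
    refine Finset.measurable_sum _ fun u hu => ?_
    rw [Finset.mem_Ico] at hu
    exact (hm u (Finset.mem_Icc.2 ⟨by omega, by omega⟩)).mono (ℱ.le _) le_rfl
  · have hT' : (0 : ℝ) < T := by exact_mod_cast hT
    -- Union bound over at most `T ^ 2` windows, each failing with probability at most `2 / T ^ 6`.
    refine (measureReal_biUnion_finset_le _ _).trans ?_
    refine (Finset.sum_le_card_nsmul _ _ (2 * ((T : ℝ) ^ 6)⁻¹) fun p hp => ?_).trans ?_
    · obtain ⟨h1, h2, h3⟩ := hmem p hp
      exact measureReal_abs_window_gt hT h2 (hasSubgaussianMGF_noise_window hm hη h1 p.2 h3)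
    · rw [nsmul_eq_mul]
      calc (W.card : ℝ) * (2 * ((T : ℝ) ^ 6)⁻¹) ≤ (T : ℝ) ^ 2 * (2 * ((T : ℝ) ^ 6)⁻¹) := by gcongr
        _ = 2 * ((T : ℝ) ^ 4)⁻¹ := by field_simp
  · intro ω hω s n hs hn hsn
    by_contra! hlt
    refine hω (Set.mem_biUnion (x := (s, n)) ?_ hlt)
    simp only [hW, Finset.coe_filter, Finset.mem_product, Finset.mem_Icc, Set.mem_ofPred_eq]
    omega

end Concentration

/-! ### Sampling until `S` good arms are found -/

section Sampling

variable {Ω : Type*} {mΩ : MeasurableSpace Ω} {P : Measure Ω}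

theorem goodCount_succ (δ : ℝ) (x : ℕ → ℝ) (i : ℕ) :
    goodCount δ x (i + 1) = goodCount δ x i + if x i < δ then 1 else 0 := by
  simp only [goodCount, Finset.card_filter, Finset.sum_range_succ]

/-- At most `S` good arms are sampled before `S` good arms have been sampled. -/
theorem sum_good_le (δ : ℝ) (x : ℕ → ℝ) (S n : ℕ) :
    ∑ i ∈ Finset.range n, (if goodCount δ x i < S then (if x i < δ then 1 else 0) else 0) ≤ S := by
  -- The bound by `S` alone is not inductive; the one by `min S (goodCount δ x n)` is.
  suffices h : ∑ i ∈ Finset.range n,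
      (if goodCount δ x i < S then (if x i < δ then 1 else 0) else 0) ≤ min S (goodCount δ x n) from
    h.trans (min_le_left _ _)
  induction n with
  | zero => simp
  | succ n ih =>
    rw [Finset.sum_range_succ, goodCount_succ]
    split_ifs <;> omega

/-- The count is a function of the first `i` gaps only, which are jointly independent of gap `i`. -/
theorem indepFun_goodCount {x : ℕ → Ω → ℝ} (hind : iIndepFun x P) (hx : ∀ i, Measurable (x i))
    (δ : ℝ) (i : ℕ) : IndepFun (fun ω => goodCount δ (fun k => x k ω) i) (x i) P := by
  have h := hind.indepFun_finset (Finset.range i) {i} (by simp) hx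
  have hφ : Measurable fun v : (Finset.range i → ℝ) => ∑ k, if v k < δ then 1 else 0 :=
    Finset.measurable_sum _ fun k _ =>
      Measurable.ite (measurableSet_lt (measurable_pi_apply k) measurable_const)
        measurable_const measurable_const
  have hψ : Measurable fun v : (({i} : Finset ℕ) → ℝ) => v ⟨i, by simp⟩ := measurable_pi_apply _
  have := h.comp hφ hψ
  refine this.congr (ae_of_all _ fun ω => ?_) (ae_of_all _ fun ω => rfl)
  simp only [goodCount, Finset.card_filter, Function.comp]
  exact (Finset.sum_coe_sort (Finset.range i) (fun k => if x k ω < δ then 1 else 0))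

theorem measurable_goodCount {x : ℕ → Ω → ℝ} (hx : ∀ i, Measurable (x i)) (δ : ℝ) (i : ℕ) :
    Measurable fun ω => goodCount δ (fun k => x k ω) i := by
  simp only [goodCount, Finset.card_filter]
  exact Finset.measurable_sum _ fun k _ =>
    Measurable.ite (measurableSet_lt (hx k) measurable_const) measurable_const measurable_const

theorem integral_ite_goodCount {x : ℕ → Ω → ℝ} (hind : iIndepFun x P)
    (hx : ∀ i, Measurable (x i)) (δ : ℝ) (S i : ℕ) {g : ℝ → ℝ} (hg : Measurable g) :
    ∫ ω, (if goodCount δ (fun k => x k ω) i < S then g (x i ω) else 0) ∂P =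
      P.real {ω | goodCount δ (fun k => x k ω) i < S} * ∫ ω, g (x i ω) ∂P := by
  have hu : Measurable fun n : ℕ => if n < S then (1 : ℝ) else 0 := Measurable.of_discrete
  have h := (indepFun_goodCount hind hx δ i).comp hu hg
  have h1 := h.integral_fun_mul_eq_mul_integral
    (hu.comp (measurable_goodCount hx δ i)).aestronglyMeasurable
    (hg.comp (hx i)).aestronglyMeasurable
  simp only [Function.comp] at h1
  have h2 : ∫ ω, (if goodCount δ (fun k => x k ω) i < S then (1 : ℝ) else 0) ∂P =
      P.real {ω | goodCount δ (fun k => x k ω) i < S} := by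
    rw [← integral_indicator_one
      (measurableSet_lt (measurable_goodCount hx δ i) measurable_const)]
    congr 1
    funext ω
    simp [Set.indicator_apply]
  rw [← h2, ← h1]
  congr 1
  funext ω
  split_ifs <;> simp

variable [IsProbabilityMeasure P]

/-- Wald's identity, as an inequality, for sampling until `S` good arms have been found. -/
theorem integral_sum_goodCount_le {x : ℕ → Ω → ℝ} (hind : iIndepFun x P)
    (hx : ∀ i, Measurable (x i)) {δ p K Q : ℝ} (S T : ℕ) {g : ℝ → ℝ} (hg : Measurable g)
    (hgK : ∀ y, |g y| ≤ K) (hp : 0 < p) (hQ0 : 0 ≤ Q) (hpx : ∀ i, p ≤ P.real {ω | x i ω < δ})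
    (hQ : ∀ i, ∫ ω, g (x i ω) ∂P ≤ Q) :
    ∫ ω, ∑ i ∈ Finset.range T,
      (if goodCount δ (fun k => x k ω) i < S then g (x i ω) else 0) ∂P ≤ S / p * Q := by
  have hint : ∀ {f : ℝ → ℝ} {K : ℝ}, Measurable f → (∀ y, |f y| ≤ K) → ∀ i,
      Integrable (fun ω => if goodCount δ (fun k => x k ω) i < S then f (x i ω) else 0) P := by
    intro f K hf hK i
    refine Integrable.of_bound (C := K) (Measurable.ite
      (measurableSet_lt (measurable_goodCount hx δ i) measurable_const) (hf.comp (hx i))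
      measurable_const).aestronglyMeasurable (ae_of_all _ fun ω => ?_)
    split_ifs
    · exact hK _
    · rw [norm_zero]
      exact (abs_nonneg _).trans (hK 0)
  set N := ∑ i ∈ Finset.range T, P.real {ω | goodCount δ (fun k => x k ω) i < S} with hN
  -- `N` is the expected number of arms sampled. The factorization applied to the indicator of a
  -- good arm bounds `N * p` by the expected number of good arms sampled.
  have hNp : N * p ≤ S := by
    set f : ℝ → ℝ := fun y => if y < δ then 1 else 0 with hf
    have hfm : Measurable f := Measurable.ite measurableSet_Iio measurable_const measurable_const
    have hfi := hint (f := f) (K := 1) hfm (fun y => by simp only [hf]; split_ifs <;> simp)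
    calc N * p ≤ ∑ i ∈ Finset.range T, P.real {ω | goodCount δ (fun k => x k ω) i < S} *
            ∫ ω, f (x i ω) ∂P := by
          rw [hN, Finset.sum_mul]
          refine Finset.sum_le_sum fun i _ => ?_
          gcongr
          refine (hpx i).trans (le_of_eq ?_)
          rw [← integral_indicator_one (measurableSet_lt (hx i) measurable_const)]
          rfl
      _ = ∫ ω, ∑ i ∈ Finset.range T,
            (if goodCount δ (fun k => x k ω) i < S then f (x i ω) else 0) ∂P := by
          rw [integral_finsetSum _ fun i _ => hfi i]
          exact Finset.sum_congr rfl fun i _ => (integral_ite_goodCount hind hx δ S i hfm).symm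
      _ ≤ ∫ _, (S : ℝ) ∂P := by
          refine integral_mono (integrable_finsetSum _ fun i _ => hfi i) (integrable_const _)
            fun ω => ?_
          have := sum_good_le δ (fun k => x k ω) S T
          simp only [hf]
          exact_mod_cast this
      _ = S := by simp
  rw [integral_finsetSum _ fun i _ => hint hg hgK i]
  calc ∑ i ∈ Finset.range T,
        ∫ ω, (if goodCount δ (fun k => x k ω) i < S then g (x i ω) else 0) ∂P
      ≤ ∑ i ∈ Finset.range T, P.real {ω | goodCount δ (fun k => x k ω) i < S} * Q := by
        refine Finset.sum_le_sum fun i _ => ?_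
        rw [integral_ite_goodCount hind hx δ S i hg]
        gcongr
        exact hQ i
    _ = N * Q := by rw [hN, Finset.sum_mul]
    _ ≤ S / p * Q := by
        gcongr
        rwa [le_div_iff₀ hp]

theorem measurable_truncInv (δ : ℝ) : Measurable (truncInv δ) :=
  Measurable.ite measurableSet_Ioi measurable_inv measurable_const

theorem abs_truncInv_le {δ : ℝ} (hδ : 0 < δ) (y : ℝ) : |truncInv δ y| ≤ (2 * δ)⁻¹ := by
  rw [abs_of_nonneg (truncInv_nonneg hδ y), truncInv]
  split_ifs with h
  · exact inv_anti₀ (by positivity) h.le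
  · positivity

/-- Dyadic decomposition of the truncated inverse. -/
theorem truncInv_le_sum {δ : ℝ} (hδ : 0 < δ) {J : ℕ} (hJ : 1 ≤ 2 * δ * 2 ^ J) (y : ℝ) :
    truncInv δ y ≤
      2 + ∑ j ∈ Finset.range J, 4 * 2 ^ j * (if y < ((2 : ℝ) ^ j)⁻¹ then 1 else 0) := by
  have hnn : ∀ j ∈ Finset.range J,
      (0 : ℝ) ≤ 4 * 2 ^ j * (if y < ((2 : ℝ) ^ j)⁻¹ then 1 else 0) := fun j _ => by
    split_ifs <;> positivity
  have hs := Finset.sum_nonneg hnn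
  rw [truncInv]
  split_ifs with h
  · have hy : 0 < y := by linarith
    rcases le_or_gt y⁻¹ 2 with h2 | h2
    · linarith
    -- With `n = k + 1` and `2 ^ (k + 1) ≤ 1 / y < 2 ^ (k + 2)`, the single term `j = k` dominates
    -- `1 / y`.
    · obtain ⟨n, hn1, hn2⟩ := exists_nat_pow_near (show 1 ≤ y⁻¹ by linarith)
        (one_lt_two : (1 : ℝ) < 2)
      have hn0 : n ≠ 0 := by
        rintro rfl
        norm_num at hn2
        linarith
      obtain ⟨k, rfl⟩ := Nat.exists_eq_succ_of_ne_zero hn0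
      have hkJ : k < J := by
        have h3 : (2 : ℝ) ^ (k + 1) < 2 ^ J := by
          refine hn1.trans_lt ?_
          rw [inv_lt_iff_one_lt_mul₀ hy]
          refine hJ.trans_lt ?_
          rw [mul_comm]
          gcongr
        have := (pow_lt_pow_iff_right₀ (one_lt_two : (1 : ℝ) < 2)).1 h3
        omega
      have hlt : y < ((2 : ℝ) ^ k)⁻¹ := by
        rw [lt_inv_comm₀ hy (by positivity)]
        refine lt_of_lt_of_le ?_ hn1
        exact pow_lt_pow_right₀ one_lt_two (Nat.lt_succ_self k)
      have h4 := Finset.single_le_sum hnn (Finset.mem_range.2 hkJ)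
      rw [if_pos hlt] at h4
      rw [pow_succ, pow_succ] at hn2
      linarith
  · linarith

/-- The tail bound at scale `2 ^ (-j)` turns the dyadic sum into a geometric one of ratio `2 ^ (1 -
β)`; whether the ratio exceeds 1 separates the two regimes of `β`. -/
theorem integral_truncInv_le {X : Ω → ℝ} (hX : Measurable X) {β ch δ : ℝ} (hδ : 0 < δ)
    (htail : ∀ z ∈ Set.Icc (0 : ℝ) 1, P.real {ω | X ω < z} ≤ ch * z ^ β) {J : ℕ}
    (hJ : 1 ≤ 2 * δ * 2 ^ J) :
    ∫ ω, truncInv δ (X ω) ∂P ≤ 2 + 4 * ch * ∑ j ∈ Finset.range J, ((2 : ℝ) ^ (1 - β)) ^ j := by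
  have hset : ∀ j : ℕ, MeasurableSet {ω | X ω < ((2 : ℝ) ^ j)⁻¹} := fun j =>
    measurableSet_lt hX measurable_const
  have hfun : ∀ j : ℕ, (fun ω => if X ω < ((2 : ℝ) ^ j)⁻¹ then (1 : ℝ) else 0) =
      Set.indicator {ω | X ω < ((2 : ℝ) ^ j)⁻¹} 1 := fun j => rfl
  have hind : ∀ j ∈ Finset.range J,
      Integrable (fun ω => 4 * 2 ^ j * (if X ω < ((2 : ℝ) ^ j)⁻¹ then (1 : ℝ) else 0)) P :=
    fun j _ => Integrable.const_mul (by
      rw [hfun]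
      exact (integrable_const (1 : ℝ)).indicator (hset j)) _
  have htr : Integrable (fun ω => truncInv δ (X ω)) P :=
    Integrable.of_bound (C := (2 * δ)⁻¹)
      ((measurable_truncInv δ).comp hX).aestronglyMeasurable
      (ae_of_all _ fun ω => abs_truncInv_le hδ _)
  calc ∫ ω, truncInv δ (X ω) ∂P
      ≤ ∫ ω, (2 + ∑ j ∈ Finset.range J,
          4 * 2 ^ j * (if X ω < ((2 : ℝ) ^ j)⁻¹ then 1 else 0)) ∂P :=
        integral_mono htr ((integrable_const _).add (integrable_finsetSum _ hind))
          fun ω => truncInv_le_sum hδ hJ (X ω)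
    _ = 2 + ∑ j ∈ Finset.range J, 4 * 2 ^ j * P.real {ω | X ω < ((2 : ℝ) ^ j)⁻¹} := by
        rw [integral_add (integrable_const _) (integrable_finsetSum _ hind),
          integral_finsetSum _ hind]
        congr 1
        · simp
        · refine Finset.sum_congr rfl fun j _ => ?_
          rw [integral_const_mul, hfun, integral_indicator_one (hset j)]
    _ ≤ _ := by
        rw [Finset.mul_sum]
        refine add_le_add le_rfl (Finset.sum_le_sum fun j _ => ?_)
        have h2 : (0 : ℝ) < 2 ^ j := by positivity
        have h1 := htail ((2 : ℝ) ^ j)⁻¹ ⟨by positivity, inv_le_one_of_one_le₀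
          (one_le_pow₀ one_le_two)⟩
        have h3 : ((2 : ℝ) ^ (1 - β)) ^ j = 2 ^ j * (((2 : ℝ) ^ j)⁻¹) ^ β := by
          rw [← Real.rpow_natCast, ← Real.rpow_mul (by norm_num), mul_comm (1 - β),
            Real.rpow_mul (by norm_num), Real.rpow_natCast, Real.rpow_sub h2, Real.rpow_one,
            Real.inv_rpow h2.le, div_eq_mul_inv]
        rw [h3]
        calc 4 * 2 ^ j * P.real {ω | X ω < ((2 : ℝ) ^ j)⁻¹}
            ≤ 4 * 2 ^ j * (ch * (((2 : ℝ) ^ j)⁻¹) ^ β) := by gcongr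
          _ = 4 * ch * (2 ^ j * (((2 : ℝ) ^ j)⁻¹) ^ β) := by ring

theorem exists_dyadic_scale {δ : ℝ} (hδ : 0 < δ) (hδ1 : δ ≤ 1) :
    ∃ J : ℕ, 1 ≤ 2 * δ * 2 ^ J ∧ (2 : ℝ) ^ J ≤ δ⁻¹ := by
  obtain ⟨n, h1, h2⟩ := exists_nat_pow_near (one_le_inv₀ hδ |>.2 hδ1) (one_lt_two : (1 : ℝ) < 2)
  refine ⟨n, ?_, h1⟩
  rw [inv_lt_iff_one_lt_mul₀ hδ, pow_succ] at h2
  linarith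

/-- The ratio is at most 1, so the sum is at most its number of terms, which is `O(log (1 / δ))`. -/
theorem integral_truncInv_le_log {X : Ω → ℝ} (hX : Measurable X) {β ch δ : ℝ} (hβ : 1 ≤ β)
    (hch : 0 < ch) (hδ : 0 < δ) (hδ1 : δ ≤ 1)
    (htail : ∀ z ∈ Set.Icc (0 : ℝ) 1, P.real {ω | X ω < z} ≤ ch * z ^ β) :
    ∫ ω, truncInv δ (X ω) ∂P ≤ 2 + 8 * ch * Real.log δ⁻¹ := by
  obtain ⟨J, h1, h2⟩ := exists_dyadic_scale hδ hδ1
  refine (integral_truncInv_le hX hδ htail h1).trans ?_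
  have hq : (2 : ℝ) ^ (1 - β) ≤ 1 := Real.rpow_le_one_of_one_le_of_nonpos one_le_two (by linarith)
  have hsum : ∑ j ∈ Finset.range J, ((2 : ℝ) ^ (1 - β)) ^ j ≤ J := by
    refine (Finset.sum_le_card_nsmul _ _ 1 fun j _ => ?_).trans (by simp)
    exact pow_le_one₀ (by positivity) hq
  have hJ : (J : ℝ) ≤ 2 * Real.log δ⁻¹ := by
    have := Real.log_le_log (by positivity) h2
    rw [Real.log_pow] at this
    have hJ0 : (0 : ℝ) ≤ J := Nat.cast_nonneg J
    nlinarith [Real.log_two_gt_d9]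
  nlinarith

/-- The ratio exceeds 1, so the geometric sum is of the order of `(2 ^ J) ^ (1 - β) ≤ δ ^ (β - 1)`.
-/
theorem integral_truncInv_le_rpow {X : Ω → ℝ} (hX : Measurable X) {β ch δ : ℝ} (hβ : β < 1)
    (hch : 0 < ch) (hδ : 0 < δ) (hδ1 : δ ≤ 1)
    (htail : ∀ z ∈ Set.Icc (0 : ℝ) 1, P.real {ω | X ω < z} ≤ ch * z ^ β) :
    ∫ ω, truncInv δ (X ω) ∂P ≤ (2 + 4 * ch / ((2 : ℝ) ^ (1 - β) - 1)) * δ ^ (β - 1) := by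
  obtain ⟨J, h1, h2⟩ := exists_dyadic_scale hδ hδ1
  refine (integral_truncInv_le hX hδ htail h1).trans ?_
  have hq : 1 < (2 : ℝ) ^ (1 - β) := Real.one_lt_rpow one_lt_two (by linarith)
  have hq' : 0 < (2 : ℝ) ^ (1 - β) - 1 := by linarith
  have hpow : ((2 : ℝ) ^ (1 - β)) ^ J ≤ δ ^ (β - 1) := by
    rw [← Real.rpow_natCast, ← Real.rpow_mul (by norm_num), mul_comm (1 - β),
      Real.rpow_mul (by norm_num), Real.rpow_natCast]
    refine (Real.rpow_le_rpow (by positivity) h2 (by linarith)).trans (le_of_eq ?_)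
    rw [Real.inv_rpow hδ.le, ← Real.rpow_neg hδ.le]
    congr 1
    ring
  have hone : 1 ≤ δ ^ (β - 1) := Real.one_le_rpow_of_pos_of_le_one_of_nonpos hδ hδ1 (by linarith)
  rw [geom_sum_eq hq.ne']
  calc 2 + 4 * ch * ((((2 : ℝ) ^ (1 - β)) ^ J - 1) / ((2 : ℝ) ^ (1 - β) - 1))
      ≤ 2 * δ ^ (β - 1) + 4 * ch * (δ ^ (β - 1) / ((2 : ℝ) ^ (1 - β) - 1)) := by
        gcongr
        · linarith
        · linarith
    _ = _ := by ring

end Sampling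

/-! ### Expected regret for a general threshold -/

section Regret

variable {Ω : Type*} {mΩ : MeasurableSpace Ω} {P : Measure Ω} [IsProbabilityMeasure P]
  {ℱ : Filtration ℕ mΩ} {𝒜 : Type*} {β cl ch : ℝ} {T S : ℕ} {μ₁ : 𝒜 → Ω → ℝ} {η ρ : ℕ → Ω → ℝ}

theorem IsAbruptRottingEnv.integrable_rot (hE : IsAbruptRottingEnv P ℱ β cl ch T S μ₁ η ρ)
    {t : ℕ} (ht : t ∈ Finset.Ico 1 T) : Integrable (ρ t) P := by
  refine Integrable.of_bound (C := T)
    ((hE.rot_meas t ht).mono (ℱ.le t) le_rfl).aestronglyMeasurable ?_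
  have hnn : ∀ᵐ ω ∂P, ∀ s ∈ Finset.Ico 1 T, 0 ≤ ρ s ω :=
    (Finset.eventually_all _).2 hE.rot_nonneg
  filter_upwards [hnn, hE.rot_total] with ω h1 h2
  rw [Real.norm_of_nonneg (h1 t ht)]
  exact (Finset.single_le_sum (f := fun s => ρ s ω) h1 ht).trans h2

/-- The expected regret in terms of the threshold and of a bound `Q` for the expected truncated
inverse of the initial gaps. -/
theorem integral_regretRV_le [DecidableEq 𝒜] (hE : IsAbruptRottingEnv P ℱ β cl ch T S μ₁ η ρ)
    (hT : 2 ≤ T) (hcl : 0 < cl) {δ : ℝ} (hδ : 0 < δ) (hδ1 : δ ≤ 1) {order : ℕ → 𝒜}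
    (hord : Function.Injective order) {Q : ℝ} (hQ0 : 0 ≤ Q)
    (hQ : ∀ i, ∫ ω, truncInv δ (1 - μ₁ (order i) ω) ∂P ≤ Q) :
    Integrable (regretRV T δ order μ₁ η ρ) P ∧
      ∫ ω, regretRV T δ order μ₁ η ρ ω ∂P ≤ 2 * δ * T +
        386 * Real.log T * (S / (cl * δ ^ β) * Q) +
        (S * (1 + 4 * Real.sqrt (12 * Real.log T) + 192 * Real.log T / δ) +
          expectedRotting P ρ T) + 4 := by
  set x : ℕ → Ω → ℝ := fun i ω => 1 - μ₁ (order i) ω with hxdef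
  have hx : ∀ i, Measurable (x i) := fun i =>
    measurable_const.sub ((hE.mean_meas (order i)).mono (ℱ.le 0) le_rfl)
  have hind : iIndepFun x P :=
    (hE.mean_indep.precomp hord).comp (fun _ y => 1 - y) fun _ => measurable_const.sub measurable_id
  have htraj : ∀ ω, IsTrajectory T δ (fun i => x i ω) (fun t => η t ω) (fun t => ρ t ω)
      (fun t => (run T δ order (fun y => μ₁ y ω) (fun t => η t ω) (fun t => ρ t ω) t).idx)
      (fun t => (run T δ order (fun y => μ₁ y ω) (fun t => η t ω) (fun t => ρ t ω) t).start)
      (runGap T δ order (fun y => μ₁ y ω) (fun t => η t ω) (fun t => ρ t ω)) :=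
    fun ω => isTrajectory_run (m := fun y => μ₁ y ω) hord
  have hreg : regretRV T δ order μ₁ η ρ = fun ω => ∑ t ∈ Finset.Icc 1 T,
      runGap T δ order (fun y => μ₁ y ω) (fun t => η t ω) (fun t => ρ t ω) t := rfl
  have hmeas : Measurable (regretRV T δ order μ₁ η ρ) := by
    rw [hreg]
    refine Finset.measurable_sum _ fun t ht => ?_
    rw [Finset.mem_Icc] at ht
    exact (measurable_trajectory
      (D := fun t ω => runGap T δ order (fun y => μ₁ y ω) (fun t => η t ω) (fun t => ρ t ω) t)
      htraj hx (fun t ht => (hE.noise_meas t ht).mono (ℱ.le t) le_rfl)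
      (fun t ht => (hE.rot_meas t ht).mono (ℱ.le t) le_rfl) ht.1 ht.2).2.2
  have hT1 : (1 : ℝ) ≤ T := by exact_mod_cast (by omega : 1 ≤ T)
  have hρnn : ∀ᵐ ω ∂P, ∀ s ∈ Finset.Ico 1 T, 0 ≤ ρ s ω :=
    (Finset.eventually_all _).2 hE.rot_nonneg
  have hxmem : ∀ᵐ ω ∂P, ∀ i, 0 ≤ x i ω ∧ x i ω ≤ 1 := by
    refine ae_all_iff.2 fun i => ?_
    filter_upwards [hE.mean_mem (order i)] with ω hω
    simp only [hxdef]
    exact ⟨by linarith [hω.2], by linarith [hω.1]⟩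
  have hnonneg : ∀ᵐ ω ∂P, 0 ≤ regretRV T δ order μ₁ η ρ ω := by
    filter_upwards [hρnn, hxmem] with ω h1 h2
    rw [hreg]
    refine Finset.sum_nonneg fun t ht => ?_
    rw [Finset.mem_Icc] at ht
    exact (htraj ω).gap_nonneg (fun i => (h2 i).1) h1 ht.1 ht.2
  -- Every gap is at most 1 plus the total rotting. This bound serves both for integrability and on
  -- the bad noise event.
  have hcrude : ∀ᵐ ω ∂P, regretRV T δ order μ₁ η ρ ω ≤ 2 * (T : ℝ) ^ 2 := by
    filter_upwards [hρnn, hxmem, hE.rot_total] with ω h1 h2 h3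
    rw [hreg]
    refine (Finset.sum_le_card_nsmul _ _ (1 + T : ℝ) fun t ht => ?_).trans ?_
    · rw [Finset.mem_Icc] at ht
      exact ((htraj ω).gap_le (fun i => (h2 i).2) h1 ht.1 ht.2).trans (by linarith)
    · rw [nsmul_eq_mul, Nat.card_Icc, Nat.add_sub_cancel]
      nlinarith
  have hint : Integrable (regretRV T δ order μ₁ η ρ) P := by
    refine Integrable.of_bound (C := 2 * (T : ℝ) ^ 2) hmeas.aestronglyMeasurable ?_
    filter_upwards [hnonneg, hcrude] with ω h1 h2
    rwa [Real.norm_of_nonneg h1]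
  refine ⟨hint, ?_⟩
  obtain ⟨A, hAm, hAP, hA⟩ := exists_noise_event (by omega : 1 ≤ T) hE.noise_meas
    hE.noise_subGaussian
  set W : Ω → ℝ := fun ω => ∑ i ∈ Finset.range T,
    (if goodCount δ (fun k => x k ω) i < S then truncInv δ (x i ω) else 0) with hW
  have hWint : Integrable W P := by
    refine integrable_finsetSum _ fun i _ => Integrable.of_bound (C := (2 * δ)⁻¹)
      (Measurable.ite (measurableSet_lt (measurable_goodCount hx δ i) measurable_const)
        ((measurable_truncInv δ).comp (hx i)) measurable_const).aestronglyMeasurable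
      (ae_of_all _ fun ω => ?_)
    split_ifs
    · exact abs_truncInv_le hδ _
    · rw [norm_zero]
      positivity
  have hWnn : ∀ ω, 0 ≤ W ω := fun ω => Finset.sum_nonneg fun i _ => by
    split_ifs
    · exact truncInv_nonneg hδ _
    · exact le_rfl
  have hWle : ∫ ω, W ω ∂P ≤ S / (cl * δ ^ β) * Q := by
    refine integral_sum_goodCount_le hind hx S T (measurable_truncInv δ) (abs_truncInv_le hδ)
      (mul_pos hcl (Real.rpow_pos_of_pos hδ β)) hQ0 (fun i => ?_) hQ
    exact (hE.mean_tail (order i) δ ⟨hδ.le, hδ1⟩).1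
  have hVint : Integrable (fun ω => ∑ s ∈ Finset.Ico 1 T, ρ s ω) P :=
    integrable_finsetSum _ fun s hs => hE.integrable_rot hs
  have hV : ∫ ω, ∑ s ∈ Finset.Ico 1 T, ρ s ω ∂P = expectedRotting P ρ T :=
    integral_finsetSum _ fun s hs => hE.integrable_rot hs
  set c := 2 * δ * T + S * (1 + 4 * Real.sqrt (12 * Real.log T) + 192 * Real.log T / δ) with hc
  have hlog := Real.log_natCast_nonneg T
  have hc0 : 0 ≤ c := by positivity
  have hbound : ∀ᵐ ω ∂P, regretRV T δ order μ₁ η ρ ω ≤ c + 386 * Real.log T * W ω +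
      ∑ s ∈ Finset.Ico 1 T, ρ s ω + A.indicator (fun _ => 2 * (T : ℝ) ^ 2) ω := by
    filter_upwards [hρnn, hxmem, hcrude, hE.rot_abrupt] with ω h1 h2 h3 h4
    by_cases hω : ω ∈ A
    · rw [Set.indicator_of_mem hω]
      have h5 := Finset.sum_nonneg h1
      have h6 : 0 ≤ 386 * Real.log T * W ω := mul_nonneg (by positivity) (hWnn ω)
      linarith
    · rw [Set.indicator_of_notMem hω]
      have h5 := (htraj ω).sum_gap_le (hA ω hω) hT hδ h4 (fun i => (h2 i).2) h1
      rw [hreg]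
      linarith
  have hi1 : Integrable (fun ω => c + 386 * Real.log T * W ω) P :=
    (integrable_const c).add (hWint.const_mul _)
  have hi2 : Integrable (fun ω => c + 386 * Real.log T * W ω + ∑ s ∈ Finset.Ico 1 T, ρ s ω) P :=
    hi1.add hVint
  have hi3 : Integrable (A.indicator fun _ => 2 * (T : ℝ) ^ 2) P :=
    (integrable_const _).indicator hAm
  have hle := integral_mono_ae hint (hi2.add hi3) hbound
  have hbad : ∫ ω, A.indicator (fun _ => 2 * (T : ℝ) ^ 2) ω ∂P ≤ 4 := by
    rw [integral_indicator_const _ hAm, smul_eq_mul]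
    calc P.real A * (2 * (T : ℝ) ^ 2) ≤ 2 * ((T : ℝ) ^ 4)⁻¹ * (2 * (T : ℝ) ^ 2) := by gcongr
      _ = 4 * ((T : ℝ) ^ 2)⁻¹ := by
          field_simp
          norm_num
      _ ≤ 4 * 1 := by
          gcongr
          exact inv_le_one_of_one_le₀ (one_le_pow₀ hT1)
      _ = 4 := by norm_num
  have heq : ∫ ω, (c + 386 * Real.log T * W ω + ∑ s ∈ Finset.Ico 1 T, ρ s ω +
      A.indicator (fun _ => 2 * (T : ℝ) ^ 2) ω) ∂P = c + 386 * Real.log T * ∫ ω, W ω ∂P +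
      expectedRotting P ρ T + ∫ ω, A.indicator (fun _ => 2 * (T : ℝ) ^ 2) ω ∂P := by
    rw [integral_add hi2 hi3, integral_add hi1 hVint,
      integral_add (integrable_const c) (hWint.const_mul _), integral_const_mul, hV]
    simp
  have hW' : 386 * Real.log T * ∫ ω, W ω ∂P ≤ 386 * Real.log T * (S / (cl * δ ^ β) * Q) := by
    gcongr
  have hfin := hle.trans heq.le
  linarith

end Regret

/-! ### Balancing the threshold -/

section Rates

/-- Collecting the terms of the regret bound. -/
theorem regret_terms_le {ℓ δ S T A V Z K₁ K₂ : ℝ} (hℓ : 1 / 2 ≤ ℓ) (hA : 1 ≤ A)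
    (hS : S ≤ A) (hδT : δ * T ≤ A) (hSδ : S / δ ≤ K₁ * A) (hZ : Z ≤ K₂ * ℓ * A)
    (hK₁ : 0 ≤ K₁) (hK₂ : 0 ≤ K₂) :
    2 * δ * T + 386 * ℓ * Z + (S * (1 + 4 * Real.sqrt (12 * ℓ) + 192 * ℓ / δ) + V) + 4 ≤
      (144 + 386 * K₂ + 384 * K₁) * ℓ ^ 2 * max A V := by
  set m := max A V
  have hAm : A ≤ m := le_max_left _ _
  have hVm : V ≤ m := le_max_right _ _
  have hm : 1 ≤ m := hA.trans hAm
  have hℓ2 : 1 ≤ 4 * ℓ ^ 2 := by nlinarith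
  have hℓ3 : ℓ ≤ 2 * ℓ ^ 2 := by nlinarith
  -- The terms `2 δ T`, `S`, `V` and `4` total at most `8 m ≤ 32 ℓ ^ 2 m`; together with the 112 of
  -- `h2` this gives 144.
  have hm2 : m ≤ 4 * ℓ ^ 2 * m := le_mul_of_one_le_left (by linarith) hℓ2
  have hsqrt : Real.sqrt (12 * ℓ) ≤ 14 * ℓ := by
    refine Real.sqrt_le_iff.2 ⟨by linarith, by nlinarith⟩
  have h1 : 386 * ℓ * Z ≤ 386 * K₂ * ℓ ^ 2 * m := by
    calc 386 * ℓ * Z ≤ 386 * ℓ * (K₂ * ℓ * A) := by gcongr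
      _ ≤ 386 * ℓ * (K₂ * ℓ * m) := by gcongr
      _ = 386 * K₂ * ℓ ^ 2 * m := by ring
  have h2 : S * (4 * Real.sqrt (12 * ℓ)) ≤ 112 * ℓ ^ 2 * m := by
    calc S * (4 * Real.sqrt (12 * ℓ)) ≤ m * (4 * (14 * (2 * ℓ ^ 2))) := by
          gcongr
          · exact hS.trans hAm
          · exact hsqrt.trans (by linarith)
      _ = 112 * ℓ ^ 2 * m := by ring
  have h3 : S * (192 * ℓ / δ) ≤ 384 * K₁ * ℓ ^ 2 * m := by
    calc S * (192 * ℓ / δ) = 192 * ℓ * (S / δ) := by ring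
      _ ≤ 192 * ℓ * (K₁ * m) := by
          gcongr
          exact hSδ.trans (by gcongr)
      _ ≤ 192 * (2 * ℓ ^ 2) * (K₁ * m) := by gcongr
      _ = 384 * K₁ * ℓ ^ 2 * m := by ring
  have e : S * (1 + 4 * Real.sqrt (12 * ℓ) + 192 * ℓ / δ) =
      S + S * (4 * Real.sqrt (12 * ℓ)) + S * (192 * ℓ / δ) := by ring
  rw [e]
  linarith

variable {c₁ r : ℝ} {S T : ℕ}

theorem one_half_le_log (hT : 2 ≤ T) : 1 / 2 ≤ Real.log T := by
  have h1 : Real.log 2 ≤ Real.log T := Real.log_le_log (by norm_num) (by exact_mod_cast hT)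
  linarith [Real.log_two_gt_d9]

theorem ratio_mem (hT : 2 ≤ T) (hS : 1 ≤ S) (hST : S ≤ T) :
    0 < (S : ℝ) / T ∧ (S : ℝ) / T ≤ 1 := by
  have hT' : (0 : ℝ) < T := by exact_mod_cast (by omega : 0 < T)
  have hS' : (0 : ℝ) < S := by exact_mod_cast (by omega : 0 < S)
  exact ⟨by positivity, (div_le_one hT').2 (by exact_mod_cast hST)⟩

theorem natCast_le_rate (hT : 2 ≤ T) (hS : 1 ≤ S) (hST : S ≤ T) (hr : r ≤ 1) :
    (S : ℝ) ≤ T * ((S : ℝ) / T) ^ r := by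
  obtain ⟨h0, h1⟩ := ratio_mem hT hS hST
  have hT' : (0 : ℝ) < T := by exact_mod_cast (by omega : 0 < T)
  calc (S : ℝ) = T * ((S : ℝ) / T) ^ (1 : ℝ) := by rw [Real.rpow_one]; field_simp
    _ ≤ T * ((S : ℝ) / T) ^ r := by
        gcongr 1
        exact Real.rpow_le_rpow_of_exponent_ge h0 h1 hr

/-- With `w = S / T ≤ 1`, the claim reduces to `T w ≤ T w ^ (2 r)`, which is where `r ≤ 1 / 2` is
needed. -/
theorem div_threshold_le_rate (hT : 2 ≤ T) (hS : 1 ≤ S) (hST : S ≤ T) (hr : r ≤ 1 / 2)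
    (hc₁ : 0 < c₁) :
    (S : ℝ) / (c₁ * ((S : ℝ) / T) ^ r) ≤ c₁⁻¹ * (T * ((S : ℝ) / T) ^ r) := by
  obtain ⟨h0, h1⟩ := ratio_mem hT hS hST
  have hT' : (0 : ℝ) < T := by exact_mod_cast (by omega : 0 < T)
  have hpos := Real.rpow_pos_of_pos h0 r
  have h2 : (S : ℝ) ≤ T * (((S : ℝ) / T) ^ r * ((S : ℝ) / T) ^ r) := by
    rw [← Real.rpow_add h0]
    exact natCast_le_rate hT hS hST (by linarith)
  rw [div_le_iff₀ (by positivity)]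
  calc (S : ℝ) ≤ T * (((S : ℝ) / T) ^ r * ((S : ℝ) / T) ^ r) := h2
    _ = _ := by field_simp

theorem threshold_pos_le_one (hT : 2 ≤ T) (hS : 1 ≤ S) (hST : S ≤ T) (hr : 0 ≤ r)
    (hc₁ : 0 < c₁) (hc₁' : c₁ < 1) :
    0 < c₁ * ((S : ℝ) / T) ^ r ∧ c₁ * ((S : ℝ) / T) ^ r ≤ 1 := by
  obtain ⟨h0, h1⟩ := ratio_mem hT hS hST
  have hpos := Real.rpow_pos_of_pos h0 r
  exact ⟨by positivity, mul_le_one₀ hc₁'.le hpos.le (Real.rpow_le_one h0.le h1 hr)⟩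

theorem rate_eq_of_one_le {β : ℝ} (hβ : 0 < β) (hT : 2 ≤ T) :
    (S : ℝ) ^ (1 / (β + 1)) * (T : ℝ) ^ (β / (β + 1)) =
      T * ((S : ℝ) / T) ^ (1 / (β + 1)) := by
  have hT' : (0 : ℝ) < T := by exact_mod_cast (by omega : 0 < T)
  have e : β / (β + 1) = 1 - 1 / (β + 1) := by
    field_simp
    ring
  rw [e, Real.rpow_sub hT', Real.rpow_one, Real.div_rpow (Nat.cast_nonneg S) hT'.le]
  ring

theorem sqrt_mul_eq_rate (hT : 2 ≤ T) :
    Real.sqrt ((S : ℝ) * T) = T * ((S : ℝ) / T) ^ ((1 : ℝ) / 2) := by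
  have hT' : (0 : ℝ) < T := by exact_mod_cast (by omega : 0 < T)
  rw [← Real.sqrt_eq_rpow]
  conv_rhs => rw [← Real.sqrt_sq hT'.le, ← Real.sqrt_mul (sq_nonneg _)]
  rw [Real.sqrt_sq hT'.le]
  congr 1
  field_simp

/-- This is the balance for `β ≥ 1`: the exponent `r = 1 / (β + 1)` solves `1 - r β = r`, so `S / δ
^ β` and `δ T` agree up to constants. -/
theorem div_threshold_rpow_eq_rate {β : ℝ} (hβ : 0 < β) (hc₁ : 0 < c₁) (hT : 2 ≤ T) (hS : 1 ≤ S)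
    (hST : S ≤ T) :
    (S : ℝ) / (c₁ * ((S : ℝ) / T) ^ (1 / (β + 1))) ^ β =
      (c₁ ^ β)⁻¹ * (T * ((S : ℝ) / T) ^ (1 / (β + 1))) := by
  obtain ⟨h0, h1⟩ := ratio_mem hT hS hST
  have hT' : (0 : ℝ) < T := by exact_mod_cast (by omega : 0 < T)
  set w := (S : ℝ) / T with hw
  have hS' : (S : ℝ) = T * w := by rw [hw]; field_simp
  have hpos := Real.rpow_pos_of_pos h0 (1 / (β + 1))
  have hc := Real.rpow_pos_of_pos hc₁ β
  have hwb := Real.rpow_pos_of_pos h0 (1 / (β + 1) * β)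
  have hsplit : w ^ (1 / (β + 1)) * w ^ (1 / (β + 1) * β) = w := by
    rw [← Real.rpow_add h0]
    conv_rhs => rw [← Real.rpow_one w]
    congr 1
    field_simp
    ring
  rw [Real.mul_rpow hc₁.le hpos.le, ← Real.rpow_mul h0.le, hS', div_eq_iff (by positivity)]
  calc T * w = T * (w ^ (1 / (β + 1)) * w ^ (1 / (β + 1) * β)) := by rw [hsplit]
    _ = _ := by field_simp

/-- Since `w ^ (-r) ≤ T / S ≤ T`, the logarithm is at most `log c₁⁻¹ + log T`; the factor 2 comes
from `log T ≥ 1 / 2`. -/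
theorem log_inv_threshold_le (hT : 2 ≤ T) (hS : 1 ≤ S) (hST : S ≤ T) (hr : r ≤ 1)
    (hc₁ : 0 < c₁) (hc₁' : c₁ < 1) :
    Real.log (c₁ * ((S : ℝ) / T) ^ r)⁻¹ ≤ (2 * Real.log c₁⁻¹ + 1) * Real.log T := by
  obtain ⟨h0, h1⟩ := ratio_mem hT hS hST
  have hT' : (0 : ℝ) < T := by exact_mod_cast (by omega : 0 < T)
  have hS' : (1 : ℝ) ≤ S := by exact_mod_cast hS
  have hpos := Real.rpow_pos_of_pos h0 r
  have hℓ := one_half_le_log hT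
  have hc : 0 ≤ Real.log c₁⁻¹ := Real.log_nonneg ((one_le_inv₀ hc₁).2 hc₁'.le)
  have hle : (((S : ℝ) / T) ^ r)⁻¹ ≤ T := by
    rw [inv_le_comm₀ hpos hT']
    calc ((T : ℝ))⁻¹ ≤ (S : ℝ) / T := by
          rw [div_eq_mul_inv]
          exact le_mul_of_one_le_left (by positivity) hS'
      _ = ((S : ℝ) / T) ^ (1 : ℝ) := (Real.rpow_one _).symm
      _ ≤ _ := Real.rpow_le_rpow_of_exponent_ge h0 h1 hr
  rw [mul_inv, Real.log_mul (by positivity) (by positivity)]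
  have := Real.log_le_log (by positivity) hle
  nlinarith

end Rates

end RottingBandit

end

/-! ### The two regimes of `β` -/

theorem theorem2 (β : ℝ) (hβ : 0 < β) (c₁ : ℝ) (hc₁ : 0 < c₁) (hc₁' : c₁ < 1)
    (cl ch : ℝ) (hcl : 0 < cl) (hch : 0 < ch) :
    ∃ C : ℝ, 0 < C ∧ ∃ k : ℕ, ∀ T S : ℕ, 2 ≤ T → 1 ≤ S → S ≤ T →
      ∀ (Ω : Type*) (mΩ : MeasurableSpace Ω) (P : MeasureTheory.Measure Ω)
        (_ : MeasureTheory.IsProbabilityMeasure P) (ℱ : MeasureTheory.Filtration ℕ mΩ)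
        (𝒜 : Type*) (_ : DecidableEq 𝒜) (order : ℕ → 𝒜) (_ : Function.Injective order)
        (μ₁ : 𝒜 → Ω → ℝ) (η ρ : ℕ → Ω → ℝ),
        RottingBandit.IsAbruptRottingEnv P ℱ β cl ch T S μ₁ η ρ →
        MeasureTheory.Integrable
          (RottingBandit.regretRV T (RottingBandit.deltaS c₁ β S T) order μ₁ η ρ) P ∧
        (1 ≤ β →
          ∫ ω, RottingBandit.regretRV T (RottingBandit.deltaS c₁ β S T) order μ₁ η ρ ω ∂P ≤
          C * Real.log (T : ℝ) ^ k *
          max ((S : ℝ) ^ (1 / (β + 1)) * (T : ℝ) ^ (β / (β + 1)))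
            (RottingBandit.expectedRotting P ρ T)) ∧
        (β < 1 →
          ∫ ω, RottingBandit.regretRV T (RottingBandit.deltaS c₁ β S T) order μ₁ η ρ ω ∂P ≤
          C * Real.log (T : ℝ) ^ k *
          max (Real.sqrt ((S : ℝ) * (T : ℝ))) (RottingBandit.expectedRotting P ρ T)) := by
  open RottingBandit in
  have hK₁ : 0 ≤ c₁⁻¹ := by positivity
  have htailm : ∀ {T S : ℕ} {Ω : Type _} {mΩ : MeasurableSpace Ω} {P : Measure Ω}
      {ℱ : Filtration ℕ mΩ} {𝒜 : Type _} {μ₁ : 𝒜 → Ω → ℝ} {η ρ : ℕ → Ω → ℝ},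
      IsAbruptRottingEnv P ℱ β cl ch T S μ₁ η ρ → ∀ a, Measurable (fun ω => 1 - μ₁ a ω) ∧
        ∀ z ∈ Set.Icc (0 : ℝ) 1, P.real {ω | 1 - μ₁ a ω < z} ≤ ch * z ^ β :=
    fun {_ _ _ _ _ ℱ} _ _ _ _ hE a =>
      ⟨measurable_const.sub ((hE.mean_meas a).mono (ℱ.le 0) le_rfl),
        fun z hz => (hE.mean_tail a z hz).2⟩
  rcases le_or_gt 1 β with hβ1 | hβ1
  · set K₂ := (c₁ ^ β)⁻¹ / cl * (4 + 8 * ch * (2 * Real.log c₁⁻¹ + 1)) with hK₂def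
    have hc : 0 ≤ Real.log c₁⁻¹ := Real.log_nonneg ((one_le_inv₀ hc₁).2 hc₁'.le)
    have hcβ := Real.rpow_pos_of_pos hc₁ β
    have hK₂ : 0 ≤ K₂ := by positivity
    refine ⟨144 + 386 * K₂ + 384 * c₁⁻¹, by positivity, 2, ?_⟩
    intro T S hT hS hST Ω mΩ P _ ℱ 𝒜 _ order hord μ₁ η ρ hE
    have hr : 1 / (β + 1) ≤ 1 / 2 := one_div_le_one_div_of_le (by norm_num) (by linarith)
    have hr0 : 0 ≤ 1 / (β + 1) := by positivity
    obtain ⟨hδ, hδ1⟩ := threshold_pos_le_one hT hS hST hr0 hc₁ hc₁'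
    have hSA := natCast_le_rate hT hS hST (show 1 / (β + 1) ≤ 1 by linarith)
    have hSδ := div_threshold_le_rate hT hS hST hr hc₁
    have hpow := div_threshold_rpow_eq_rate hβ hc₁ hT hS hST
    have hlogδ := log_inv_threshold_le hT hS hST (show 1 / (β + 1) ≤ 1 by linarith) hc₁ hc₁'
    have hℓ := one_half_le_log hT
    rw [deltaS, if_pos hβ1, rate_eq_of_one_le hβ hT]
    set δ := c₁ * ((S : ℝ) / T) ^ (1 / (β + 1)) with hδdef
    set A := (T : ℝ) * ((S : ℝ) / T) ^ (1 / (β + 1)) with hAdef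
    have hA : 1 ≤ A := le_trans (by exact_mod_cast hS) hSA
    have hQ0 : 0 ≤ 2 + 8 * ch * Real.log δ⁻¹ := by
      have := Real.log_nonneg ((one_le_inv₀ hδ).2 hδ1)
      positivity
    obtain ⟨hint, hle⟩ := integral_regretRV_le hE hT hcl hδ hδ1 hord hQ0 fun i =>
      integral_truncInv_le_log (htailm hE (order i)).1 hβ1 hch hδ hδ1 (htailm hE (order i)).2
    refine ⟨hint, fun _ => hle.trans ?_, fun h => absurd hβ1 (not_le.2 h)⟩
    refine regret_terms_le hℓ hA hSA ?_ hSδ ?_ hK₁ hK₂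
    · calc δ * T = c₁ * A := by rw [hδdef, hAdef]; ring
        _ ≤ A := mul_le_of_le_one_left (by linarith) hc₁'.le
    · calc (S : ℝ) / (cl * δ ^ β) * (2 + 8 * ch * Real.log δ⁻¹)
          = (S / δ ^ β) / cl * (2 + 8 * ch * Real.log δ⁻¹) := by
            rw [mul_comm cl, ← div_div]
        _ ≤ ((c₁ ^ β)⁻¹ * A) / cl *
            (4 * Real.log T + 8 * ch * ((2 * Real.log c₁⁻¹ + 1) * Real.log T)) := by
            rw [hpow]
            gcongr
            linarith
        _ = K₂ * Real.log T * A := by rw [hK₂def]; ring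
  · set Q := 2 + 4 * ch / ((2 : ℝ) ^ (1 - β) - 1) with hQdef
    have hq : 0 < (2 : ℝ) ^ (1 - β) - 1 :=
      sub_pos.2 (Real.one_lt_rpow one_lt_two (by linarith))
    have hQ : 0 ≤ Q := by positivity
    set K₂ := 2 * (Q / cl * c₁⁻¹) with hK₂def
    have hK₂ : 0 ≤ K₂ := by positivity
    refine ⟨144 + 386 * K₂ + 384 * c₁⁻¹, by positivity, 2, ?_⟩
    intro T S hT hS hST Ω mΩ P _ ℱ 𝒜 _ order hord μ₁ η ρ hE
    obtain ⟨hδ, hδ1⟩ := threshold_pos_le_one (r := 1 / 2) hT hS hST (by norm_num) hc₁ hc₁'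
    have hSA := natCast_le_rate (r := 1 / 2) hT hS hST (by norm_num)
    have hSδ := div_threshold_le_rate (r := 1 / 2) hT hS hST le_rfl hc₁
    have hℓ := one_half_le_log hT
    rw [deltaS, if_neg (not_le.2 hβ1), sqrt_mul_eq_rate hT]
    set δ := c₁ * ((S : ℝ) / T) ^ ((1 : ℝ) / 2) with hδdef
    set A := (T : ℝ) * ((S : ℝ) / T) ^ ((1 : ℝ) / 2) with hAdef
    have hA : 1 ≤ A := le_trans (by exact_mod_cast hS) hSA
    have hδβ := Real.rpow_pos_of_pos hδ β
    obtain ⟨hint, hle⟩ := integral_regretRV_le hE hT hcl hδ hδ1 hord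
      (mul_nonneg hQ (Real.rpow_pos_of_pos hδ (β - 1)).le) fun i =>
      integral_truncInv_le_rpow (htailm hE (order i)).1 hβ1 hch hδ hδ1 (htailm hE (order i)).2
    refine ⟨hint, fun h => absurd h (not_le.2 hβ1), fun _ => hle.trans ?_⟩
    refine regret_terms_le hℓ hA hSA ?_ hSδ ?_ hK₁ hK₂
    · calc δ * T = c₁ * A := by rw [hδdef, hAdef]; ring
        _ ≤ A := mul_le_of_le_one_left (by linarith) hc₁'.le
    -- For `β < 1` the powers of `δ` combine to `S / δ`, whatever `β` is; hence the exponent `1 /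
    -- 2`.
    · calc (S : ℝ) / (cl * δ ^ β) * (Q * δ ^ (β - 1)) = Q / cl * (S / δ) := by
            rw [Real.rpow_sub hδ, Real.rpow_one]
            field_simp
        _ ≤ Q / cl * (c₁⁻¹ * A) := by gcongr
        -- The factor `2 log T ≥ 1` only serves to match the form required by `regret_terms_le`.
        _ ≤ Q / cl * (c₁⁻¹ * A) * (2 * Real.log T) :=
            le_mul_of_one_le_right (by positivity) (by linarith)
        _ = K₂ * Real.log T * A := by rw [hK₂def]; ring
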